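/- Let $k$ be an algebraically closed field of characteristic $0$, let $R = k[[x,y]]$, and let $f \in R$ be the germ of an isolated plane curve singularity, i.e. $f(0)=0$ and $\dim_k R/(f,\partial f/\partial x,\partial f/\partial y) < \infty$. Let $\delta_1,\dots,\delta_d \in R$ represent a $k$-basis of the space of first-order deformations $\mathrm{Def}^1(f) = R/(f,\partial f/\partial x,\partial f/\partial y)$. For $a \in k^d$, the associated one-parameter deformation $X/B$ of $f$ has $\mathcal O_B = k[[t]]$ and $\mathcal O_X = R[[t]]/(F)$ with $F = f + t\sum_i a_i\delta_i$. It is called admissible if the locus $\mathrm{Sing}(X/B)$, cut out in $\mathcal O_X$ by $\partial F/\partial x$ and $\partial F/\partial y$, has codimension at least $2$ in $X$. For $m \ge 1$ put $\mathcal P^m_{X/B} = (\mathcal O_X\otimes_{\mathcal O_B}\mathcal O_X)/I_\Delta^m$, where $I_\Delta$ is the kernel of multiplication. For a list $\tau = (\tau_1,\dots,\tau_m)$ of elements of $\mathcal P^m_{X/B}$ let $I_\tau^m = \bigl(\det (e_i(\tau_j))\bigr) \subset \mathcal O_X$, where $(e_1,\dots,e_m)$ is a basis of the dual $\mathcal O_X$-module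 $(\mathcal P^m_{X/B})^\vee$. The $m$-th order weight-$1$ automatic degeneracy of $f$ is $$\mathrm{AD}_{(1)}^m(f) = \min_{X/B}\ \min_{\tau}\ \dim_k \mathcal O_X/\bigl((t) + I_\tau^m\bigr),$$ the minima being over all admissible one-parameter deformations $X/B$ and all lists $\tau$ of $m$ elements of $\mathcal P^m_{X/B}$. Let $J(f) = (\partial f/\partial x,\partial f/\partial y) \subset R/(f)$ be the Jacobian ideal. Then its Hilbert–Samuel multiplicity $e_f = \lim_{s\to\infty} \frac1s \dim_k R/(f, J(f)^s)$ exists, is a non-negative integer, and $$\mathrm{AD}_{(1)}^2(f) = e_f .$$ In particular, the number of second-order weight-$1$ inflection points limiting to the singularity in a general one-parameter deformation is $e_f$. That is, for all $a$ in some non-empty Zariski-open subset of $k^d$, the deformation $X/B$ is admissible, $(\mathcal P^2_{X/B})^\vee$ is free of rank $2$, the minimum $\mathrm{AD}_{(1)}^2(f)$ is attained by some $\tau$ in $\mathcal P^2_{X/B}$, and for every $\tau$ attaining it $$\dim_{K} \bigl(\mathcal O_X/I_\tau^2\bigr)\otimes_{k[[t]]} K = e_f, \qquad K = \overline{k((t))}.$$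 -/

import Mathlib

open scoped TensorProduct Topology

noncomputable section

namespace AutDeg

/-- The dimension of a vector space, with value `⊤` when it is infinite. -/
def vdim (K V : Type*) [Field K] [AddCommGroup V] [Module K V] : ℕ∞ :=
  Cardinal.toENat (Module.rank K V)

section Germ

variable (k : Type*) [Field k]

/-- The ring `R = k[[x, y]]`; the variable `x` has index `0` and `y` has index `1`. -/
abbrev PlaneRing : Type _ := MvPowerSeries (Fin 2) k

variable {k}

/-- The ideal `(f, ∂f/∂x, ∂f/∂y)` of `R`. -/
def tjurinaIdeal (f : PlaneRing k) : Ideal (PlaneRing k) :=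
  Ideal.span {f, MvPowerSeries.pderiv k 0 f, MvPowerSeries.pderiv k 1 f}

/-- `f` is the germ of an isolated complete intersection singularity in the plane: it vanishes
at the origin and the scheme `f = ∂f/∂x = ∂f/∂y = 0` is supported at the origin (has finite
length). In particular `f ≠ 0`. Smooth germs are not excluded. -/
structure IsPlanarICIS (f : PlaneRing k) : Prop where
  vanishes : MvPowerSeries.constantCoeff f = 0
  isolated : FiniteDimensional k (PlaneRing k ⧸ tjurinaIdeal f)

/-- The power series `δ i` represent a `k`-basis of the space
`Def¹(f) = R / (f, ∂f/∂x, ∂f/∂y)` of first-order deformations of `f`. -/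
def IsDeformationBasis (f : PlaneRing k) {d : ℕ} (δ : Fin d → PlaneRing k) : Prop :=
  ∃ b : Module.Basis (Fin d) k (PlaneRing k ⧸ tjurinaIdeal f),
    ∀ i, b i = Ideal.Quotient.mk (tjurinaIdeal f) (δ i)

/-- The Jacobian ideal `J(f) = (∂f/∂x, ∂f/∂y)` of `R / (f)`. -/
def jacobianIdeal (f : PlaneRing k) : Ideal (PlaneRing k ⧸ Ideal.span {f}) :=
  Ideal.span {Ideal.Quotient.mk (Ideal.span {f}) (MvPowerSeries.pderiv k 0 f),
    Ideal.Quotient.mk (Ideal.span {f}) (MvPowerSeries.pderiv k 1 f)}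

/-- `e` is the Hilbert-Samuel multiplicity of the ideal `I` of the (one-dimensional)
`k`-algebra `A`: all powers of `I` have finite colength, and `dim_k (A / I ^ s) / s`
tends to `e` as `s → ∞`. -/
def HasHilbertSamuelMultiplicity (k : Type*) [Field k] {A : Type*} [CommRing A] [Algebra k A]
    (I : Ideal A) (e : ℝ) : Prop :=
  (∀ s : ℕ, FiniteDimensional k (A ⧸ I ^ s)) ∧
    Filter.Tendsto (fun s : ℕ => (Module.finrank k (A ⧸ I ^ s) : ℝ) / (s : ℝ))
      Filter.atTop (𝓝 e)

end Germ

section Deformation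

variable {k : Type*} [Field k] (f : PlaneRing k) {d : ℕ} (δ : Fin d → PlaneRing k)
  (a : Fin d → k)

/-- The equation `F = f + t · ∑ aᵢ δᵢ` in `R[[t]]` of the one-parameter deformation obtained
from the versal family `f + ∑ αᵢ δᵢ` by the base change `αᵢ ↦ aᵢ t`. -/
def deformationEq : PowerSeries (PlaneRing k) :=
  PowerSeries.C f + PowerSeries.X * PowerSeries.C (∑ i, a i • δ i)

/-- The coordinate ring `𝒪_X = R[[t]] / (F)` of the total space of the one-parameter deformation
`X / B`. It is an algebra over the coordinate ring `𝒪_B = k[[t]]` of the base. -/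
abbrev TotalRing : Type _ :=
  PowerSeries (PlaneRing k) ⧸ Ideal.span {deformationEq f δ a}

/-- The partial derivative of an element of `R[[t]] = k[[x, y]][[t]]` with respect to one of the
variables `x`, `y`, taken coefficient by coefficient in `t`. -/
def fiberDeriv (i : Fin 2) (F : PowerSeries (PlaneRing k)) : PowerSeries (PlaneRing k) :=
  PowerSeries.mk fun n => MvPowerSeries.pderiv k i (PowerSeries.coeff n F)

/-- The ideal `(∂F/∂x, ∂F/∂y)` of `𝒪_X`, which cuts out the locus `Sing(X/B)` where
`X → B` is not smooth. -/
def singIdeal : Ideal (TotalRing f δ a) :=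
  Ideal.span {Ideal.Quotient.mk _ (fiberDeriv 0 (deformationEq f δ a)),
    Ideal.Quotient.mk _ (fiberDeriv 1 (deformationEq f δ a))}

/-- The deformation `X / B` is an admissible family: `Sing(X/B)` has codimension (at least) `2`
in `X`. The other requirements on an admissible family (flatness over `B`, fibres that are reduced
complete intersection curves) then hold for every deformation of an isolated plane curve
singularity. -/
def IsAdmissible : Prop := 2 ≤ (singIdeal f δ a).height

/-- The ideal `I_{X₀} = (t)` of the special fibre in `𝒪_X`. -/
def specialFiberIdeal : Ideal (TotalRing f δ a) :=
  Ideal.span {algebraMap (PowerSeries k) (TotalRing f δ a) PowerSeries.X}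

/-- The module of principal parts `(𝒪_X ⊗_{𝒪_B} 𝒪_X) / I_Δ ^ m`, where `I_Δ` is the kernel of the
multiplication map; `𝒪_X` acts through the left factor. Replacing the tensor product by
its completion `k[[x,y,u,v,t]] / (F(x,y,t), F(u,v,t))` divides this module by elements that every
functional with values in `𝒪_X` kills, so it changes none of the matrices below. -/
abbrev PrincipalParts (m : ℕ) : Type _ :=
  (TotalRing f δ a ⊗[PowerSeries k] TotalRing f δ a) ⧸
    (KaehlerDifferential.ideal (PowerSeries k) (TotalRing f δ a)) ^ m

/-- The ideal of maximal minors of the `m × m` matrix `(e_i (τ_j))`, for functionals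
`e_1, …, e_m` on the module of principal parts and elements `τ_1, …, τ_m` of it. When the `e_i` are
a basis of the dual module, it cuts out the degeneracy locus of the map
`𝒪_X ^ m → (principal parts)^∨∨` given by `τ_1, …, τ_m`. -/
def degeneracyIdeal {m : ℕ}
    (e : Fin m → Module.Dual (TotalRing f δ a) (PrincipalParts f δ a m))
    (τ : Fin m → PrincipalParts f δ a m) : Ideal (TotalRing f δ a) :=
  Ideal.span {Matrix.det (Matrix.of fun i j => e i (τ j))}

/-- `dim_k 𝒪_X / (I_{X₀} + I)`. -/
def specialMultiplicity (I : Ideal (TotalRing f δ a)) : ℕ∞ :=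
  vdim k (TotalRing f δ a ⧸ (specialFiberIdeal f δ a ⊔ I))

/-- An algebraic closure of the fraction field `k((t))` of `𝒪_B`, that is, the residue field
of the geometric generic point `η` of `B`. -/
abbrev GeometricGenericField (k : Type*) [Field k] : Type _ :=
  AlgebraicClosure (FractionRing (PowerSeries k))

/-- The multiplicity of the scheme cut out by `I` in the geometric generic fibre `X_η`:
the dimension of `(𝒪_X / I) ⊗ κ(η)` over `κ(η)`. -/
def genericMultiplicity (I : Ideal (TotalRing f δ a)) : ℕ∞ :=
  vdim (GeometricGenericField k)
    (GeometricGenericField k ⊗[PowerSeries k] (TotalRing f δ a ⧸ I))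

end Deformation

/-- The `m`-th order weight-1 automatic degeneracy of `f`, computed with the basis `δ` of
`Def¹(f)`: the minimum of `dim_k 𝒪_X / (I_{X₀} + I_τ)` over all (admissible) one-parameter
deformations `X / B` and all lists `τ` of `m` principal parts, where `I_τ` is formed with a basis
`e` of the dual of the module of principal parts (it does not depend on `e`). -/
def weightOneAutDeg {k : Type*} [Field k] (m : ℕ) (f : PlaneRing k) {d : ℕ}
    (δ : Fin d → PlaneRing k) : ℕ∞ :=
  sInf {n : ℕ∞ | ∃ a : Fin d → k, IsAdmissible f δ a ∧
    ∃ (e : Module.Basis (Fin m) (TotalRing f δ a)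
        (Module.Dual (TotalRing f δ a) (PrincipalParts f δ a m)))
      (τ : Fin m → PrincipalParts f δ a m),
      n = specialMultiplicity f δ a (degeneracyIdeal f δ a e τ)}

end AutDeg

end

/-! Functionals on principal parts of order two are differential operators of order at most one, so
the dual is `O_X` plus the derivations of `O_X` over `k[[t]]` (`exists_derivation_of_functional`). A
derivation `D` applied to `F = 0` gives the syzygy `(Dx, Dy)` of `(F_x, F_y)`. For an admissible
family `(F_x, F_y)` contains a regular sequence: a power of `t` and a lift of an element of `J(f)`
of finite colength. Hence all syzygies are Koszul and the derivations are free on the Hamiltonian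
`F_y ∂_x - F_x ∂_y` (`IsAdmissible.exists_smul_hamiltonian`, `dualBasis`).

In this basis the second row of the matrix takes values in `(F_x, F_y)`, and every element of that
ideal occurs as a determinant. So the ideals `I_τ` are exactly the `(h)` with `h` in `(F_x, F_y)`.
Restricted to `t = 0`, these are the principal ideals inside `J(f)`, whichever admissible family was
chosen.

The least colength of such an ideal is `e_f` (`exists_hasHilbertSamuelMultiplicity`): over an
infinite field a suitable combination of the two generators of `J(f)` generates a reduction, which
makes the colength of `J(f)^s` eventually linear in `s`.

When `(h)` has finite colength on the special fibre, `O_X / (h)` is free over `k[[t]]`, so its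
length is the same on the geometric generic fibre (`IsPlanarICIS.genericMultiplicity_eq`).

In the singular case a family is admissible as soon as `∑ aᵢ δᵢ` is a unit
(`IsPlanarICIS.isAdmissible_of_isUnit`). On a curve in `Sing(X/B)` not lying over `t = 0`, `d/dt`
extends to the function field in characteristic zero; differentiating `F = 0` leaves `F_t = 0`,
although `F_t = ∑ aᵢ δᵢ`. -/

noncomputable section

namespace AutDeg

/-! ### Syzygies of two elements, and ideals of finite colength -/

section Algebra

/-- If `(p, q)` contains a regular sequence `s, w`, then all syzygies of `(p, q)` are trivial. -/
theorem exists_eq_mul_of_syzygy {O : Type*} [CommRing O] {p q s w α β : O}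
    (hs : s ∈ Ideal.span {p, q}) (hw : w ∈ Ideal.span {p, q})
    (hs0 : s ∈ nonZeroDivisors O) (hsw : ∀ x, s ∣ w * x → s ∣ x)
    (h : α * p + β * q = 0) : ∃ c, α = c * q ∧ β = -(c * p) := by
  obtain ⟨a, b, hab⟩ := Ideal.mem_span_pair.1 hs
  obtain ⟨a', b', hab'⟩ := Ideal.mem_span_pair.1 hw
  have cancel : ∀ x, s * x = 0 → x = 0 := fun x hx => by
    rw [mul_comm] at hx
    exact (mul_right_mem_nonZeroDivisors_eq_zero_iff hs0).1 hx
  -- The two sides differ by `a' * b - a * b'` times the syzygy `h`. As `w` is regular modulo `s`,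
  -- it follows that `s` divides `b * α - a * β`; the quotient is the required `c`.
  have e : w * (b * α - a * β) = s * (b' * α - a' * β) := by
    refine sub_eq_zero.1 (cancel _ ?_)
    rw [← hab, ← hab']
    linear_combination (a' * b - a * b') * (a * p + b * q) * h
  obtain ⟨c, hc⟩ := hsw _ ⟨_, e⟩
  refine ⟨c, sub_eq_zero.1 (cancel _ ?_), sub_eq_zero.1 (cancel _ ?_)⟩
  · linear_combination a * h + q * hc - α * hab
  · linear_combination b * h - p * hc - β * hab

/-- `A / I` is Artinian, so the only prime that can contain `I` is the maximal ideal. -/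
theorem exists_pow_mem_of_finiteDimensional (k : Type*) {A : Type*} [Field k] [CommRing A]
    [Algebra k A] [IsLocalRing A] (I : Ideal A) [FiniteDimensional k (A ⧸ I)] {z : A}
    (hz : z ∈ IsLocalRing.maximalIdeal A) : ∃ n, z ^ n ∈ I := by
  have : IsArtinianRing (A ⧸ I) := isArtinian_of_tower k inferInstance
  change z ∈ I.radical
  rw [Ideal.radical_eq_sInf, Ideal.mem_sInf]
  rintro P ⟨hIP, hP⟩
  have hmax : P.IsMaximal := by
    have h1 : (P.map (Ideal.Quotient.mk I)).IsPrime :=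
      Ideal.map_isPrime_of_surjective Ideal.Quotient.mk_surjective (by simpa using hIP)
    have h2 := Ideal.comap_isMaximal_of_surjective (Ideal.Quotient.mk I)
      Ideal.Quotient.mk_surjective (K := P.map (Ideal.Quotient.mk I))
    rwa [Ideal.comap_map_of_surjective _ Ideal.Quotient.mk_surjective, ← RingHom.ker_eq_comap_bot,
      Ideal.mk_ker, sup_eq_left.2 hIP] at h2
  rwa [IsLocalRing.eq_maximalIdeal hmax]

/-- Some power of `z` is a multiple of `h`, and factors of regular elements are regular. -/
theorem mem_nonZeroDivisors_of_finiteDimensional (k : Type*) {A : Type*} [Field k] [CommRing A]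
    [Algebra k A] [IsLocalRing A] {h z : A} [FiniteDimensional k (A ⧸ Ideal.span {h})]
    (hz : z ∈ IsLocalRing.maximalIdeal A) (hz0 : z ∈ nonZeroDivisors A) :
    h ∈ nonZeroDivisors A := by
  obtain ⟨n, hn⟩ := exists_pow_mem_of_finiteDimensional k (Ideal.span {h}) hz
  obtain ⟨g, hg⟩ := Ideal.mem_span_singleton.1 hn
  exact (mul_mem_nonZeroDivisors.1 (hg ▸ pow_mem hz0 n)).1

end Algebra

/-! ### Generation and independence over `k[[t]]`, tested modulo `t` -/

section PowerSeriesModules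

variable {k : Type*} [Field k] {M : Type*} [AddCommGroup M] [Module (PowerSeries k) M]

-- Successive approximation. The coefficients found at each stage are assembled in `k[[X]]`, which
-- is complete, so `M` itself only has to be separated.
open PowerSeries in
theorem span_eq_top_of_separated {ι : Type*} [Fintype ι] (v : ι → M)
    (hsep : ∀ x : M, (∀ n : ℕ, ∃ y : M, x = (X : PowerSeries k) ^ n • y) → x = 0)
    (hv : ∀ x : M, ∃ c : ι → k, ∃ y : M, x = ∑ i, (C (c i) : PowerSeries k) • v i +
      (X : PowerSeries k) • y) :
    Submodule.span (PowerSeries k) (Set.range v) = ⊤ := by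
  rw [eq_top_iff]
  rintro x -
  choose c y hcy using hv
  let z : ℕ → M := fun n => y^[n] x
  have hz : ∀ n, z n = ∑ i, (C (c (z n) i) : PowerSeries k) • v i + (X : PowerSeries k) • z (n + 1) := by
    intro n
    have : z (n + 1) = y (z n) := Function.iterate_succ_apply' y n x
    rw [this]; exact hcy _
  let g : ι → PowerSeries k := fun i => PowerSeries.mk fun n => c (z n) i
  have hx : x = ∑ i, g i • v i := by
    refine sub_eq_zero.1 (hsep _ fun n => ?_)
    let tail : ℕ → ι → PowerSeries k := fun n i => PowerSeries.mk fun j => c (z (n + j)) i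
    refine ⟨z n - ∑ i, tail n i • v i, ?_⟩
    induction n with
    | zero => simp [tail, g, z]
    | succ n ih =>
      rw [ih, pow_succ, mul_smul]
      congr 1
      have ht : ∀ i, tail n i = C (c (z n) i) + X * tail (n + 1) i := by
        intro i
        ext j
        cases j with
        | zero => simp [tail]
        | succ j => simp [tail, coeff_succ_X_mul, add_assoc, add_comm 1 j]
      have hs : ∑ i, tail n i • v i = ∑ i, (C (c (z n) i) : PowerSeries k) • v i +
          ∑ i, (X : PowerSeries k) • tail (n + 1) i • v i := by
        rw [← Finset.sum_add_distrib]
        exact Finset.sum_congr rfl fun i _ => by rw [ht i, add_smul, mul_smul]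
      rw [hs, smul_sub, Finset.smul_sum, sub_eq_iff_eq_add]
      refine (hz n).trans ?_
      abel
  rw [hx]
  exact Submodule.sum_mem _ fun i _ => Submodule.smul_mem _ _ (Submodule.subset_span ⟨i, rfl⟩)

-- Independence modulo `X` kills the constant terms of a relation; torsion-freeness then allows
-- division by `X`, and the argument repeats on the next coefficients.
open PowerSeries in
theorem linearIndependent_of_torsionFree {ι : Type*} [Fintype ι] (v : ι → M)
    (htf : ∀ x : M, (X : PowerSeries k) • x = 0 → x = 0)
    (hv : ∀ c : ι → k, ∀ y : M, ∑ i, (C (c i) : PowerSeries k) • v i =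
      (X : PowerSeries k) • y → c = 0) :
    LinearIndependent (PowerSeries k) v := by
  rw [Fintype.linearIndependent_iff]
  suffices H : ∀ n (g : ι → PowerSeries k), ∑ i, g i • v i = 0 → ∀ i, coeff n (g i) = 0 by
    intro g hg i
    ext n
    simpa using H n g hg i
  intro n
  have key : ∀ g : ι → PowerSeries k, ∑ i, g i • v i = 0 →
      ∃ g' : ι → PowerSeries k, (∀ i, g i = X * g' i) ∧ ∑ i, g' i • v i = 0 := by
    intro g hg
    let g' : ι → PowerSeries k := fun i => PowerSeries.mk fun n => coeff (n + 1) (g i)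
    have hgg : ∀ i, g i = C (constantCoeff (g i)) + X * g' i := fun i => by
      rw [add_comm]; exact eq_X_mul_shift_add_const (g i)
    have h1 : ∑ i, (C (constantCoeff (g i)) : PowerSeries k) • v i =
        (X : PowerSeries k) • (-∑ i, g' i • v i) := by
      rw [smul_neg, eq_neg_iff_add_eq_zero, ← hg, Finset.smul_sum, ← Finset.sum_add_distrib]
      exact Finset.sum_congr rfl fun i _ => by
        conv_rhs => rw [hgg i]
        rw [add_smul, mul_smul]
    have h0 := hv _ _ h1
    refine ⟨g', fun i => ?_, htf _ ?_⟩
    · conv_lhs => rw [hgg i]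
      rw [congrFun h0 i]; simp
    · rw [← neg_eq_zero, ← smul_neg, ← h1]
      exact Finset.sum_eq_zero fun i _ => by rw [congrFun h0 i]; simp
  induction n with
  | zero =>
    intro g hg i
    obtain ⟨g', h, -⟩ := key g hg
    simp [h i]
  | succ n ih =>
    intro g hg i
    obtain ⟨g', h, h'⟩ := key g hg
    rw [h i, coeff_succ_X_mul]
    exact ih g' h' i

end PowerSeriesModules

/-! ### Colengths, principal reductions and the Hilbert–Samuel multiplicity -/

section Multiplicity

variable (k : Type*) [Field k] {A : Type*} [CommRing A] [Algebra k A]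

/-- Multiplication by `x` as a `k`-linear map `A / K → A / xK`. -/
def mulQuotient (x : A) (K : Ideal A) : (A ⧸ K) →ₗ[k] A ⧸ (Ideal.span {x} * K) :=
  (Submodule.mapQ K (Ideal.span {x} * K) (LinearMap.mulLeft A x) fun _ hy =>
    Ideal.mul_mem_mul (Ideal.mem_span_singleton_self x) hy).restrictScalars k

theorem mulQuotient_mk (x y : A) (K : Ideal A) :
    mulQuotient k x K (Ideal.Quotient.mk K y) = Ideal.Quotient.mk _ (x * y) := rfl

/-- The colength formulas below come from the sequence `A/K → A/xK → A/x → 0`, which is short exact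
when `x` is regular. -/
theorem exact_mulQuotient (x : A) (K : Ideal A) :
    Function.Exact (mulQuotient k x K)
      (Ideal.Quotient.factorₐ k (Ideal.mul_le_left : Ideal.span {x} * K ≤ Ideal.span {x})).toLinearMap := by
  intro y
  obtain ⟨y, rfl⟩ := Ideal.Quotient.mk_surjective y
  constructor
  · intro h
    obtain ⟨a, ha⟩ := Ideal.mem_span_singleton.1 (Ideal.Quotient.eq_zero_iff_mem.1 h)
    exact ⟨Ideal.Quotient.mk _ a, by rw [mulQuotient_mk, ha]⟩
  · rintro ⟨a, ha⟩
    obtain ⟨a, rfl⟩ := Ideal.Quotient.mk_surjective a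
    rw [← ha, mulQuotient_mk]
    exact Ideal.Quotient.eq_zero_iff_mem.2
      (Ideal.mul_mem_right _ _ (Ideal.mem_span_singleton_self x))

theorem injective_mulQuotient {x : A} (hx : x ∈ nonZeroDivisors A) (K : Ideal A) :
    Function.Injective (mulQuotient k x K) := by
  rw [injective_iff_map_eq_zero]
  intro y h
  obtain ⟨y, rfl⟩ := Ideal.Quotient.mk_surjective y
  obtain ⟨a, ha, hax⟩ := Ideal.mem_span_singleton_mul.1 (Ideal.Quotient.eq_zero_iff_mem.1 h)
  rw [Ideal.Quotient.eq_zero_iff_mem, ← (mul_cancel_left_mem_nonZeroDivisors hx).1 hax]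
  exact ha

theorem surjective_factor {I J : Ideal A} (h : I ≤ J) :
    Function.Surjective (Ideal.Quotient.factorₐ k h).toLinearMap :=
  Ideal.Quotient.factor_surjective h

theorem finiteDimensional_quotient_of_le {I J : Ideal A} (h : I ≤ J)
    [FiniteDimensional k (A ⧸ I)] : FiniteDimensional k (A ⧸ J) :=
  Module.Finite.of_surjective _ (surjective_factor k h)

theorem finrank_quotient_le_of_le {I J : Ideal A} (h : I ≤ J)
    [FiniteDimensional k (A ⧸ I)] : Module.finrank k (A ⧸ J) ≤ Module.finrank k (A ⧸ I) :=
  LinearMap.finrank_le_finrank_of_surjective (surjective_factor k h)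

theorem finiteDimensional_quotient_mul (x : A) (K : Ideal A) [FiniteDimensional k (A ⧸ K)]
    [FiniteDimensional k (A ⧸ Ideal.span {x})] :
    FiniteDimensional k (A ⧸ (Ideal.span {x} * K)) := by
  have h := exact_mulQuotient k x K
  refine ⟨Submodule.fg_of_fg_map_of_fg_inf_ker
    (Ideal.Quotient.factorₐ k (Ideal.mul_le_left : Ideal.span {x} * K ≤ Ideal.span {x})).toLinearMap
    (IsNoetherian.noetherian _) ?_⟩
  rw [top_inf_eq, LinearMap.exact_iff.1 h]
  exact Module.Finite.iff_fg.1 (Module.Finite.range _)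

theorem finrank_quotient_mul_le (x : A) (K : Ideal A) [FiniteDimensional k (A ⧸ K)]
    [FiniteDimensional k (A ⧸ Ideal.span {x})] :
    Module.finrank k (A ⧸ (Ideal.span {x} * K)) ≤
      Module.finrank k (A ⧸ K) + Module.finrank k (A ⧸ Ideal.span {x}) := by
  have h := exact_mulQuotient k x K
  have := finiteDimensional_quotient_mul k x K
  have h1 := LinearMap.finrank_range_add_finrank_ker
    (Ideal.Quotient.factorₐ k (Ideal.mul_le_left : Ideal.span {x} * K ≤ Ideal.span {x})).toLinearMap
  rw [LinearMap.exact_iff.1 h, LinearMap.range_eq_top.2 (surjective_factor k _), finrank_top] at h1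
  have h2 := LinearMap.finrank_range_le (mulQuotient k x K)
  omega

theorem finrank_quotient_mul {x : A} (hx : x ∈ nonZeroDivisors A) (K : Ideal A)
    [FiniteDimensional k (A ⧸ K)] [FiniteDimensional k (A ⧸ Ideal.span {x})] :
    Module.finrank k (A ⧸ (Ideal.span {x} * K)) =
      Module.finrank k (A ⧸ K) + Module.finrank k (A ⧸ Ideal.span {x}) := by
  have h := exact_mulQuotient k x K
  have := finiteDimensional_quotient_mul k x K
  have h1 := LinearMap.finrank_range_add_finrank_ker
    (Ideal.Quotient.factorₐ k (Ideal.mul_le_left : Ideal.span {x} * K ≤ Ideal.span {x})).toLinearMap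
  rw [LinearMap.exact_iff.1 h, LinearMap.range_eq_top.2 (surjective_factor k _), finrank_top] at h1
  have h2 := LinearMap.finrank_range_of_inj (injective_mulQuotient k hx K)
  omega

theorem finiteDimensional_quotient_span_pow (x : A) [FiniteDimensional k (A ⧸ Ideal.span {x})]
    (s : ℕ) : FiniteDimensional k (A ⧸ Ideal.span {x} ^ s) := by
  induction s with
  | zero =>
    rw [pow_zero, Ideal.one_eq_top]
    have := Ideal.Quotient.subsingleton_iff.2 (rfl : (⊤ : Ideal A) = ⊤)
    exact Module.Finite.of_finite
  | succ s ih => rw [pow_succ']; exact finiteDimensional_quotient_mul k x _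

theorem finrank_quotient_span_pow_le (x : A) [FiniteDimensional k (A ⧸ Ideal.span {x})]
    (s : ℕ) : Module.finrank k (A ⧸ Ideal.span {x} ^ s) ≤
      s * Module.finrank k (A ⧸ Ideal.span {x}) := by
  induction s with
  | zero =>
    rw [pow_zero, Ideal.one_eq_top]
    have := Ideal.Quotient.subsingleton_iff.2 (rfl : (⊤ : Ideal A) = ⊤)
    simp [Module.finrank_zero_of_subsingleton]
  | succ s ih =>
    have := finiteDimensional_quotient_span_pow k x s
    rw [pow_succ', add_one_mul]
    exact (finrank_quotient_mul_le k x _).trans (by omega)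

/-- A power of the parameter `z` lies in `I`, so `I ^ s` contains a power of `z`, and that has
finite colength. -/
theorem finiteDimensional_quotient_pow [IsLocalRing A] (I : Ideal A)
    [FiniteDimensional k (A ⧸ I)] {z : A} (hz : z ∈ IsLocalRing.maximalIdeal A)
    [FiniteDimensional k (A ⧸ Ideal.span {z})] (s : ℕ) : FiniteDimensional k (A ⧸ I ^ s) := by
  obtain ⟨n, hn⟩ := exists_pow_mem_of_finiteDimensional k I hz
  have := finiteDimensional_quotient_span_pow k z (n * s)
  refine finiteDimensional_quotient_of_le k (I := Ideal.span {z} ^ (n * s)) ?_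
  rw [pow_mul, Ideal.span_singleton_pow]
  exact Ideal.pow_right_mono ((Ideal.span_singleton_le_iff_mem _).2 hn) s

/-- Any `dim_k (A / z) + 1` elements of an ideal `K` of finite colength satisfy a nontrivial
linear relation modulo `zK`. -/
theorem exists_relation_mod_mul {z : A} (hz0 : z ∈ nonZeroDivisors A) (K : Ideal A)
    [FiniteDimensional k (A ⧸ K)] [FiniteDimensional k (A ⧸ Ideal.span {z})] {N : ℕ}
    (hN : Module.finrank k (A ⧸ Ideal.span {z}) ≤ N) (v : Fin (N + 1) → A) (hv : ∀ i, v i ∈ K) :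
    ∃ φ : Fin (N + 1) → k, ∑ i, φ i • v i ∈ Ideal.span {z} * K ∧ φ ≠ 0 := by
  have := finiteDimensional_quotient_mul k z K
  let g := (Ideal.Quotient.factorₐ k (Ideal.mul_le_right : Ideal.span {z} * K ≤ K)).toLinearMap
  -- The kernel of `g` is `K / zK`; by additivity of colength its dimension is `dim A/z`, whatever
  -- `K` is.
  have h1 := LinearMap.finrank_range_add_finrank_ker g
  rw [LinearMap.range_eq_top.2 (surjective_factor k _), finrank_top, finrank_quotient_mul k hz0 K]
    at h1
  let w : Fin (N + 1) → LinearMap.ker g := fun i =>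
    ⟨Ideal.Quotient.mk _ (v i), Ideal.Quotient.eq_zero_iff_mem.2 (hv i)⟩
  have hw : ¬ LinearIndependent k w := fun h => by
    have := h.fintype_card_le_finrank
    rw [Fintype.card_fin] at this
    omega
  rw [Fintype.linearIndependent_iff] at hw
  push Not at hw
  obtain ⟨φ, hφ, i, hi⟩ := hw
  refine ⟨φ, ?_, fun h => hi (congrFun h i)⟩
  have h2 := congrArg Subtype.val hφ
  rw [← Ideal.Quotient.eq_zero_iff_mem]
  rw [Submodule.coe_sum] at h2
  refine Eq.trans ?_ h2
  rw [map_sum]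
  rfl

theorem span_pair_pow_le {p q : A} {n : ℕ} {K : Ideal A}
    (h : ∀ j ≤ n, p ^ j * q ^ (n - j) ∈ K) : Ideal.span {p, q} ^ n ≤ K := by
  rw [Ideal.span_insert, ← Submodule.add_eq_sup, add_pow, Ideal.sum_eq_sup]
  refine Finset.sup_le fun j hj => ?_
  refine Ideal.mul_le_left.trans ?_
  rw [Ideal.span_singleton_pow, Ideal.span_singleton_pow, Ideal.span_singleton_mul_span_singleton,
    Ideal.span_singleton_le_iff_mem]
  exact h j (by simpa [Nat.lt_succ_iff] using hj)

theorem pow_mul_pow_mem_span_pair_pow (p q : A) {i j n : ℕ} (h : i + j = n) :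
    p ^ i * q ^ j ∈ Ideal.span {p, q} ^ n := by
  rw [← h, pow_add]
  exact Ideal.mul_mem_mul (Ideal.pow_mem_pow (Ideal.subset_span (by simp)) _)
    (Ideal.pow_mem_pow (Ideal.subset_span (by simp)) _)

/-- In a one-dimensional Cohen-Macaulay local ring, a general combination of two generators of
an ideal of finite colength generates a reduction of this ideal. -/
theorem exists_principal_reduction [Infinite k] [IsLocalRing A] [IsNoetherianRing A] (p q : A)
    [FiniteDimensional k (A ⧸ Ideal.span {p, q})] {z : A}
    (hz : z ∈ IsLocalRing.maximalIdeal A) (hz0 : z ∈ nonZeroDivisors A)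
    [FiniteDimensional k (A ⧸ Ideal.span {z})] :
    ∃ h ∈ Ideal.span {p, q}, ∃ n,
      Ideal.span {p, q} ^ (n + 1) = Ideal.span {h} * Ideal.span {p, q} ^ n := by
  set I := Ideal.span {p, q} with hI
  set n := Module.finrank k (A ⧸ Ideal.span {z}) with hn
  have hfin := finiteDimensional_quotient_pow k I hz (n + 1)
  -- There are `n + 2` monomials of degree `n + 1` in `p, q`, but `I ^ (n + 1) / z I ^ (n + 1)` has
  -- dimension only `n`: some nonzero form `φ` of degree `n + 1` vanishes there.
  obtain ⟨φ, hφ, hφ0⟩ := exists_relation_mod_mul k hz0 (I ^ (n + 1)) (N := n + 1) (by omega)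
    (fun j => p ^ (j : ℕ) * q ^ (n + 1 - j)) fun j =>
      pow_mul_pow_mem_span_pair_pow p q (by omega)
  -- The form `φ` is made nonzero at `(-c, 1)`. Modulo `h = p + c q` one may replace `p` by `-c q`,
  -- so the relation becomes a nonzero scalar times `q ^ (n + 1)`.
  obtain ⟨c, hc⟩ : ∃ c : k, ∑ i, φ i * (-c) ^ (i : ℕ) ≠ 0 := by
    by_contra! H
    refine hφ0 (funext fun i => ?_)
    have h0 : (∑ i : Fin (n + 1 + 1), Polynomial.monomial (i : ℕ) (φ i) : Polynomial k) = 0 := by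
      refine Polynomial.funext fun c => ?_
      rw [Polynomial.eval_finsetSum, Polynomial.eval_zero, ← H (-c)]
      simp
    have := congrArg (Polynomial.coeff · (i : ℕ)) h0
    simpa [Polynomial.finsetSum_coeff, Polynomial.coeff_monomial, Fin.val_inj] using this
  set h := p + c • q with hh
  set C := algebraMap k A c with hC
  have hhC : h = p + C * q := by rw [hh, Algebra.smul_def]
  have hhI : h ∈ I := by
    rw [hhC]
    exact I.add_mem (Ideal.subset_span (by simp)) (I.mul_mem_left _ (Ideal.subset_span (by simp)))
  have mono : ∀ j ≤ n + 1, p ^ j * q ^ (n + 1 - j) - (-C) ^ j * q ^ (n + 1) ∈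
      Ideal.span {h} * I ^ n := by
    intro j
    induction j with
    | zero => intro _; simp
    | succ j ih =>
      intro hj
      have h1 := Ideal.mul_mem_left _ (-C) (ih (by omega))
      have h2 : h * (p ^ j * q ^ (n - j)) ∈ Ideal.span {h} * I ^ n :=
        Ideal.mul_mem_mul (Ideal.mem_span_singleton_self h)
          (pow_mul_pow_mem_span_pair_pow p q (by omega))
      convert Ideal.add_mem _ h1 h2 using 1
      rw [show n + 1 - (j + 1) = n - j by omega, show n + 1 - j = n - j + 1 by omega, hhC]
      ring
  have hq : q ^ (n + 1) ∈ Ideal.span {h} * I ^ n ⊔ Ideal.span {z} * I ^ (n + 1) := by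
    have h1 : ∑ i, φ i • (p ^ (i : ℕ) * q ^ (n + 1 - i) - (-C) ^ (i : ℕ) * q ^ (n + 1)) ∈
        Ideal.span {h} * I ^ n := Ideal.sum_mem _ fun i _ => by
      rw [Algebra.smul_def]
      exact Ideal.mul_mem_left _ _ (mono i (by omega))
    have h2 := Submodule.sub_mem _ (Ideal.mem_sup_right hφ) (Ideal.mem_sup_left h1)
    rw [← Finset.sum_sub_distrib] at h2
    have h3 : ∑ i, (φ i • (p ^ (i : ℕ) * q ^ (n + 1 - i)) -
        φ i • (p ^ (i : ℕ) * q ^ (n + 1 - i) - (-C) ^ (i : ℕ) * q ^ (n + 1))) =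
        algebraMap k A (∑ i, φ i * (-c) ^ (i : ℕ)) * q ^ (n + 1) := by
      rw [map_sum, Finset.sum_mul]
      refine Finset.sum_congr rfl fun i _ => ?_
      rw [Algebra.smul_def, Algebra.smul_def, map_mul, map_pow, map_neg]
      ring
    rw [h3] at h2
    exact (Ideal.unit_mul_mem_iff_mem _ ((IsUnit.mk0 _ hc).map (algebraMap k A))).1 h2
  -- Nakayama: all monomials of degree `n + 1` lie in `h I ^ n + z I ^ (n + 1)`.
  have hle : I ^ (n + 1) ≤ Ideal.span {h} * I ^ n := by
    refine Submodule.le_of_le_smul_of_le_jacobson_bot (I := Ideal.span {z})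
      (IsNoetherian.noetherian _) ?_ (span_pair_pow_le fun j hj => ?_)
    · rw [IsLocalRing.jacobson_eq_maximalIdeal _ bot_ne_top]
      exact (Ideal.span_singleton_le_iff_mem _).2 hz
    · have h1 : p ^ j * q ^ (n + 1 - j) = (p ^ j * q ^ (n + 1 - j) - (-C) ^ j * q ^ (n + 1)) +
          (-C) ^ j * q ^ (n + 1) := by ring
      rw [h1]
      exact Ideal.add_mem _ (Ideal.mem_sup_left (mono j hj)) (Ideal.mul_mem_left _ _ hq)
  refine ⟨h, hhI, n, le_antisymm hle ?_⟩
  rw [pow_succ']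
  exact Ideal.mul_mono_left ((Ideal.span_singleton_le_iff_mem _).2 hhI)

/-- The multiplicity of an ideal `(p, q)` of finite colength in a one-dimensional Cohen-Macaulay
local ring is the least colength of a principal ideal contained in it. -/
theorem exists_hasHilbertSamuelMultiplicity [Infinite k] [IsLocalRing A] [IsNoetherianRing A]
    (p q : A) [FiniteDimensional k (A ⧸ Ideal.span {p, q})] {z : A}
    (hz : z ∈ IsLocalRing.maximalIdeal A) (hz0 : z ∈ nonZeroDivisors A)
    [FiniteDimensional k (A ⧸ Ideal.span {z})] :
    ∃ e : ℕ, HasHilbertSamuelMultiplicity k (Ideal.span {p, q}) (e : ℝ) ∧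
      (∃ h ∈ Ideal.span {p, q}, FiniteDimensional k (A ⧸ Ideal.span {h}) ∧
        Module.finrank k (A ⧸ Ideal.span {h}) = e) ∧
      ∀ h ∈ Ideal.span {p, q}, FiniteDimensional k (A ⧸ Ideal.span {h}) →
        e ≤ Module.finrank k (A ⧸ Ideal.span {h}) := by
  obtain ⟨h, hI, n, hn⟩ := exists_principal_reduction k p q hz hz0
  set I := Ideal.span {p, q}
  have hfin := finiteDimensional_quotient_pow k I hz
  have hfinh : FiniteDimensional k (A ⧸ Ideal.span {h}) :=
    finiteDimensional_quotient_of_le k (I := I ^ (n + 1)) (hn ▸ Ideal.mul_le_left)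
  have hh0 := mem_nonZeroDivisors_of_finiteDimensional k (h := h) hz hz0
  set e := Module.finrank k (A ⧸ Ideal.span {h})
  have hpow : ∀ s, I ^ (n + (s + 1)) = Ideal.span {h} * I ^ (n + s) := fun s => by
    rw [show n + (s + 1) = n + 1 + s by omega, pow_add, hn, pow_add, mul_assoc]
  -- From exponent `n` on, each further power adds exactly `dim A/h`, so the limit is `e`.
  have hrank : ∀ s, Module.finrank k (A ⧸ I ^ (n + s)) = Module.finrank k (A ⧸ I ^ n) + s * e := by
    intro s
    induction s with
    | zero => simp
    | succ s ih =>
      have := hfin (n + s)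
      rw [hpow, finrank_quotient_mul k hh0, ih]
      ring
  have hlim : Filter.Tendsto (fun s : ℕ => (Module.finrank k (A ⧸ I ^ s) : ℝ) / (s : ℝ))
      Filter.atTop (𝓝 (e : ℝ)) := by
    have h1 : Filter.Tendsto (fun s : ℕ =>
        ((Module.finrank k (A ⧸ I ^ n) : ℝ) - n * e) / (s : ℝ) + e) Filter.atTop (𝓝 (0 + e)) :=
      (tendsto_const_div_atTop_nhds_zero_nat _).add_const _
    rw [zero_add] at h1
    refine h1.congr' ?_
    filter_upwards [Filter.eventually_ge_atTop (n + 1)] with s hs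
    obtain ⟨j, rfl⟩ := Nat.exists_eq_add_of_le (show n ≤ s by omega)
    have h2 : ((n + j : ℕ) : ℝ) ≠ 0 := by exact_mod_cast (by omega : n + j ≠ 0)
    rw [hrank]
    field_simp
    push_cast
    ring
  refine ⟨e, ⟨hfin, hlim⟩, ⟨h, hI, hfinh, rfl⟩, fun g hg hgfin => ?_⟩
  -- Since `g ^ s` lies in `I ^ s`, the colength of `I ^ s` is at most `s` times that of `(g)`.
  have hle : (e : ℝ) ≤ Module.finrank k (A ⧸ Ideal.span {g}) := by
    refine le_of_tendsto hlim (Filter.eventually_atTop.2 ⟨1, fun s hs => ?_⟩)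
    have h2 : (0 : ℝ) < s := by exact_mod_cast hs
    have := finiteDimensional_quotient_span_pow k g s
    rw [div_le_iff₀ h2, mul_comm]
    exact_mod_cast (finrank_quotient_le_of_le k
      (Ideal.pow_right_mono ((Ideal.span_singleton_le_iff_mem _).2 hg) s)).trans
        (finrank_quotient_span_pow_le k g s)
  exact_mod_cast hle

end Multiplicity

/-! ### Finite length over a local `k`-algebra, and heights -/

section LocalRings

/-- Induction along a composition series, whose factors are all the residue field. -/
theorem finite_of_isFiniteLength (k : Type*) {A : Type*} [Field k] [CommRing A] [Algebra k A]
    [IsLocalRing A] [FiniteDimensional k (A ⧸ IsLocalRing.maximalIdeal A)]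
    {M : Type*} [AddCommGroup M] [Module A M] (h : IsFiniteLength A M)
    [iM : Module k M] [iT : IsScalarTower k A M] : Module.Finite k M := by
  induction h generalizing iM iT with
  | @of_subsingleton M => exact Module.Finite.of_finite (M := M)
  | @of_simple_quotient M _ _ N _ _ ih =>
    have h1 : Module.Finite k (N.restrictScalars k) :=
      ih (iM := inferInstanceAs (Module k (N.restrictScalars k)))
        (iT := ⟨fun a b c => Subtype.ext (smul_assoc a b (c : M))⟩)
    have h2 : Module.Finite k (M ⧸ N.restrictScalars k) := by
      obtain ⟨I, hI, ⟨e⟩⟩ := (isSimpleModule_iff_quot_maximal (R := A) (M := M ⧸ N)).1 inferInstance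
      obtain rfl := IsLocalRing.eq_maximalIdeal hI
      exact Module.Finite.equiv (e.symm.restrictScalars k : (A ⧸ IsLocalRing.maximalIdeal A) ≃ₗ[k] (M ⧸ N))
    exact Module.Finite.of_submodule_quotient (N.restrictScalars k)

theorem finiteDimensional_quotient_of_prime (k : Type*) {A : Type*} [Field k] [CommRing A]
    [Algebra k A] [IsLocalRing A] [IsNoetherianRing A]
    [FiniteDimensional k (A ⧸ IsLocalRing.maximalIdeal A)] (I : Ideal A)
    (h : ∀ P : Ideal A, P.IsPrime → I ≤ P → P = IsLocalRing.maximalIdeal A) :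
    FiniteDimensional k (A ⧸ I) := by
  have : Ring.KrullDimLE 0 (A ⧸ I) := by
    refine Ring.KrullDimLE.mk₀ fun P hP => ?_
    have h1 := h (P.comap (Ideal.Quotient.mk I)) inferInstance fun x hx => by
      rw [Ideal.mem_comap, Ideal.Quotient.eq_zero_iff_mem.2 hx]; exact P.zero_mem
    have h2 : (P.comap (Ideal.Quotient.mk I)).IsMaximal := h1 ▸ inferInstance
    have h3 := Ideal.map_eq_top_or_isMaximal_of_surjective (Ideal.Quotient.mk I)
      Ideal.Quotient.mk_surjective h2
    rw [Ideal.map_comap_of_surjective _ Ideal.Quotient.mk_surjective] at h3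
    exact h3.resolve_left hP.ne_top
  have : IsArtinianRing (A ⧸ I) := IsNoetherianRing.isArtinianRing_of_krullDimLE_zero
  have : IsArtinian A (A ⧸ I) :=
    (isArtinian_of_surjective_algebraMap (S := A) (R := A ⧸ I) (M := A ⧸ I)
      Ideal.Quotient.mk_surjective)
  exact finite_of_isFiniteLength k (A := A) (isFiniteLength_iff_isNoetherian_isArtinian.2 ⟨inferInstance, this⟩)

theorem two_le_height_of_lt {A : Type*} [CommRing A] {P₀ P₁ P₂ : Ideal A} [P₀.IsPrime]
    [P₁.IsPrime] [P₂.IsPrime] (h : P₀ < P₁) (h' : P₁ < P₂) : 2 ≤ P₂.height := by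
  refine le_trans ?_ (Ideal.height_add_one_le_of_lt_of_isPrime h')
  rw [← one_add_one_eq_two]
  gcongr
  exact le_trans le_add_self (Ideal.height_add_one_le_of_lt_of_isPrime h)

end LocalRings

/-! ### The ring `k[[x, y]]` and parameters on plane curve germs -/

section PlaneRing

variable {k : Type*} [Field k]

open MvPowerSeries

theorem mem_maximalIdeal_planeRing {r : PlaneRing k} :
    r ∈ IsLocalRing.maximalIdeal (PlaneRing k) ↔ constantCoeff r = 0 := by
  rw [IsLocalRing.mem_maximalIdeal, mem_nonunits_iff, isUnit_iff_constantCoeff, isUnit_iff_ne_zero,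
    not_not]

theorem planeRing_eq_const_add (r : PlaneRing k) :
    ∃ r₁ r₂ : PlaneRing k, r = algebraMap k _ (constantCoeff r) + X 0 * r₁ + X 1 * r₂ := by
  classical
  -- The part of `r` free of `X 0`; without its constant term it is divisible by `X 1`.
  let g : PlaneRing k := fun m => if m 0 = 0 then coeff m r else 0
  have hg : ∀ m, coeff m g = if m 0 = 0 then coeff m r else 0 := fun m => rfl
  obtain ⟨r₁, h₁⟩ : X 0 ∣ r - g := X_dvd_iff.2 fun m hm => by simp [hg, hm]
  obtain ⟨r₂, h₂⟩ : X 1 ∣ g - algebraMap k _ (constantCoeff r) := X_dvd_iff.2 fun m hm => by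
    rw [map_sub, hg, MvPowerSeries.algebraMap_apply, Algebra.algebraMap_self, RingHom.id_apply, coeff_C]
    by_cases h0 : m 0 = 0
    · have : m = 0 := by ext i; fin_cases i <;> assumption
      simp [this]
    · rw [if_neg h0, if_neg (fun h => h0 (by simp [h])), sub_zero]
  exact ⟨r₁, r₂, by rw [← h₁, add_assoc, ← h₂]; ring⟩

theorem maximalIdeal_planeRing :
    IsLocalRing.maximalIdeal (PlaneRing k) = Ideal.span {X 0, X 1} := by
  refine le_antisymm (fun r hr => ?_) (Ideal.span_le.2 ?_)
  · obtain ⟨r₁, r₂, h⟩ := planeRing_eq_const_add r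
    rw [mem_maximalIdeal_planeRing.1 hr, map_zero, zero_add] at h
    exact Ideal.mem_span_pair.2 ⟨r₁, r₂, by rw [h]; ring⟩
  · rintro _ (rfl | rfl) <;> exact mem_maximalIdeal_planeRing.2 (constantCoeff_X _)

instance finiteDimensional_residue_planeRing :
    FiniteDimensional k (PlaneRing k ⧸ IsLocalRing.maximalIdeal (PlaneRing k)) := by
  refine Module.Finite.of_surjective (Algebra.linearMap k _) fun r => ?_
  obtain ⟨r, rfl⟩ := Ideal.Quotient.mk_surjective r
  refine ⟨constantCoeff r, ?_⟩
  obtain ⟨r₁, r₂, h⟩ := planeRing_eq_const_add r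
  conv_rhs => rw [h]
  rw [add_assoc, map_add, (Ideal.Quotient.eq_zero_iff_mem (a := X 0 * r₁ + X 1 * r₂)).2, add_zero]
  · rfl
  · rw [maximalIdeal_planeRing, Ideal.mem_span_pair]
    exact ⟨r₁, r₂, by ring⟩

theorem X_ne_zero_planeRing (i : Fin 2) : (X i : PlaneRing k) ≠ 0 := fun h => by
  have := pderiv_X_self (R := k) (i := i)
  rw [h, map_zero] at this
  exact zero_ne_one this

/-- Multiplication by `X 1 ^ m` shifts coefficients without changing the exponent of `X 0`. Thus `X
0 ^ n, X 1 ^ m` is a regular sequence, the form in which depth two is used. -/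
theorem X_zero_pow_dvd_of_dvd_mul (n m : ℕ) (r : PlaneRing k)
    (h : (X 0 : PlaneRing k) ^ n ∣ X 1 ^ m * r) : X 0 ^ n ∣ r := by
  rw [X_pow_dvd_iff] at h ⊢
  intro d hd
  have := h (Finsupp.single 1 m + d) (by simpa using hd)
  rwa [X_pow_eq, coeff_add_monomial_mul, one_mul] at this

theorem height_maximalIdeal_planeRing_le :
    (IsLocalRing.maximalIdeal (PlaneRing k)).height ≤ 2 := by
  have h := Ideal.height_le_card_of_mem_minimalPrimes_span (p := IsLocalRing.maximalIdeal (PlaneRing k))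
    (s := {X 0, X 1}) (Set.toFinite _) (by
      rw [← maximalIdeal_planeRing, Ideal.minimalPrimes_eq_subsingleton_self]
      exact Set.mem_singleton _)
  exact h.trans (by exact_mod_cast Set.ncard_insert_le (X 0 : PlaneRing k) {X 1} |>.trans (by simp))

theorem two_le_height_maximalIdeal_planeRing :
    2 ≤ (IsLocalRing.maximalIdeal (PlaneRing k)).height := by
  have hX : (X 0 : PlaneRing k) ∈ IsLocalRing.maximalIdeal (PlaneRing k) :=
    mem_maximalIdeal_planeRing.2 (constantCoeff_X _)
  obtain ⟨Q, hQ, hQm⟩ := Ideal.exists_minimalPrimes_le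
    ((Ideal.span_singleton_le_iff_mem _).2 hX)
  have := hQ.1.1
  have hX0 : (X 0 : PlaneRing k) ∈ Q := hQ.1.2 (Ideal.mem_span_singleton_self _)
  have h0 : (⊥ : Ideal (PlaneRing k)) < Q := bot_lt_iff_ne_bot.2 fun h => by
    rw [h, Ideal.mem_bot] at hX0
    exact X_ne_zero_planeRing _ hX0
  refine two_le_height_of_lt h0 (lt_of_le_of_ne hQm fun h => ?_)
  have h1 : (X 1 : PlaneRing k) ∈ (Ideal.span {(X 0 : PlaneRing k)}).radical := by
    rw [Ideal.radical_eq_sInf, Ideal.mem_sInf]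
    rintro P ⟨hP, hP'⟩
    have h2 : Q ≤ P := hQ.2 ⟨hP', hP⟩ (h ▸ IsLocalRing.le_maximalIdeal hP'.ne_top)
    exact h2 (h ▸ mem_maximalIdeal_planeRing.2 (constantCoeff_X _))
  obtain ⟨n, hn⟩ := h1
  have h3 : (X 0 : PlaneRing k) ^ 1 ∣ X 1 ^ n * 1 := by
    rw [pow_one, mul_one]; exact Ideal.mem_span_singleton.1 hn
  have h4 := X_zero_pow_dvd_of_dvd_mul _ _ _ h3
  rw [pow_one] at h4
  have := (mem_maximalIdeal_planeRing.1 hX)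
  exact (IsLocalRing.mem_maximalIdeal _).1 hX (isUnit_of_dvd_one h4)

/-- Prime avoidance: the minimal primes over `f` have height at most one, so they do not cover the
maximal ideal. A prime containing `f` and a `z` outside all of them has height two. -/
theorem exists_parameter_planeRing {f : PlaneRing k} (hf : f ≠ 0) :
    ∃ z ∈ IsLocalRing.maximalIdeal (PlaneRing k), ∀ P : Ideal (PlaneRing k), P.IsPrime →
      f ∈ P → z ∈ P → P = IsLocalRing.maximalIdeal (PlaneRing k) := by
  have hfin := Ideal.finite_minimalPrimes_of_isNoetherianRing (PlaneRing k) (Ideal.span {f})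
  obtain ⟨z, hz, hzQ⟩ : ∃ z ∈ IsLocalRing.maximalIdeal (PlaneRing k),
      ∀ Q ∈ (Ideal.span {f}).minimalPrimes, z ∉ Q := by
    by_contra! H
    have h1 : (IsLocalRing.maximalIdeal (PlaneRing k) : Set (PlaneRing k)) ⊆
        ⋃ Q ∈ (Ideal.span {f}).minimalPrimes, (id Q : Ideal (PlaneRing k)) := fun z hz => by
      obtain ⟨Q, hQ, hzQ⟩ := H z hz
      exact Set.mem_biUnion hQ hzQ
    obtain ⟨Q, hQ, hle⟩ := (Ideal.subset_union_prime_finite hfin 0 0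
      fun Q hQ _ _ => hQ.1.1).1 h1
    have h2 : Q = IsLocalRing.maximalIdeal _ :=
      le_antisymm (IsLocalRing.le_maximalIdeal hQ.1.1.ne_top) hle
    have h3 := Ideal.height_le_one_of_isPrincipal_of_mem_minimalPrimes (Ideal.span {f}) Q hQ
    rw [h2] at h3
    exact absurd (two_le_height_maximalIdeal_planeRing.trans h3) (by norm_num)
  refine ⟨z, hz, fun P hP hfP hzP => ?_⟩
  obtain ⟨Q, hQ, hQP⟩ := Ideal.exists_minimalPrimes_le ((Ideal.span_singleton_le_iff_mem _).2 hfP)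
  have := hQ.1.1
  have hfQ : f ∈ Q := hQ.1.2 (Ideal.mem_span_singleton_self _)
  have h0 : (⊥ : Ideal (PlaneRing k)) < Q := bot_lt_iff_ne_bot.2 fun h => by
    rw [h, Ideal.mem_bot] at hfQ
    exact hf hfQ
  have h2 := two_le_height_of_lt h0 (lt_of_le_of_ne hQP fun h => hzQ Q hQ (h ▸ hzP))
  by_contra hne
  have h3 := Ideal.height_add_one_le_of_lt_of_isPrime
    (lt_of_le_of_ne (IsLocalRing.le_maximalIdeal hP.ne_top) hne)
  have h4 : (2 : ℕ∞) + 1 ≤ 2 := (add_le_add_left h2 1).trans (h3.trans height_maximalIdeal_planeRing_le)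
  exact absurd h4 (by norm_num)

theorem isLocalRing_quotient {A : Type*} [CommRing A] [IsLocalRing A] {I : Ideal A} (hI : I ≠ ⊤) :
    IsLocalRing (A ⧸ I) :=
  have := Ideal.Quotient.nontrivial_iff.2 hI
  IsLocalRing.of_surjective' (Ideal.Quotient.mk I) Ideal.Quotient.mk_surjective

theorem comap_maximalIdeal_quotient {A : Type*} [CommRing A] [IsLocalRing A] (I : Ideal A)
    [IsLocalRing (A ⧸ I)] :
    (IsLocalRing.maximalIdeal (A ⧸ I)).comap (Ideal.Quotient.mk I) = IsLocalRing.maximalIdeal A :=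
  IsLocalRing.eq_maximalIdeal (Ideal.comap_isMaximal_of_surjective _ Ideal.Quotient.mk_surjective)

theorem finiteDimensional_residue_quotient (k : Type*) {A : Type*} [Field k] [CommRing A]
    [Algebra k A] [IsLocalRing A] (I : Ideal A) [IsLocalRing (A ⧸ I)]
    [FiniteDimensional k (A ⧸ IsLocalRing.maximalIdeal A)] :
    FiniteDimensional k ((A ⧸ I) ⧸ IsLocalRing.maximalIdeal (A ⧸ I)) :=
  Module.Finite.of_surjective (Ideal.quotientMapₐ (R₁ := k) (I := IsLocalRing.maximalIdeal A)
    (IsLocalRing.maximalIdeal (A ⧸ I)) (Ideal.Quotient.mkₐ k I)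
    (comap_maximalIdeal_quotient I).ge).toLinearMap
    (Ideal.quotientMap_surjective (H := (comap_maximalIdeal_quotient I).ge)
      Ideal.Quotient.mk_surjective)

/-- A reduced plane curve germ, or more generally any plane curve germ, has a parameter. -/
theorem exists_parameter_curve {f : PlaneRing k} (hf : f ≠ 0)
    [IsLocalRing (PlaneRing k ⧸ Ideal.span {f})] :
    ∃ z ∈ IsLocalRing.maximalIdeal (PlaneRing k ⧸ Ideal.span {f}), z ∈ nonZeroDivisors _ ∧
      FiniteDimensional k ((PlaneRing k ⧸ Ideal.span {f}) ⧸ Ideal.span {z}) := by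
  obtain ⟨z, hz, hP⟩ := exists_parameter_planeRing hf
  refine ⟨Ideal.Quotient.mk _ z, ?_, ?_, ?_⟩
  · rwa [← Ideal.mem_comap, comap_maximalIdeal_quotient]
  · have hX : ∀ i : Fin 2, ∃ n, (X i : PlaneRing k) ^ n ∈ Ideal.span {f, z} := fun i => by
      change _ ∈ Ideal.radical _
      rw [Ideal.radical_eq_sInf, Ideal.mem_sInf]
      rintro P ⟨h1, h2⟩
      rw [hP P h2 (h1 (Ideal.subset_span (by simp))) (h1 (Ideal.subset_span (by simp)))]
      exact mem_maximalIdeal_planeRing.2 (constantCoeff_X _)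
    obtain ⟨n, hn⟩ := hX 0
    obtain ⟨m, hm⟩ := hX 1
    rw [mem_nonZeroDivisors_iff_right]
    intro a ha
    obtain ⟨a, rfl⟩ := Ideal.Quotient.mk_surjective a
    rw [← map_mul, Ideal.Quotient.eq_zero_iff_mem] at ha
    obtain ⟨b, hb⟩ := Ideal.mem_span_singleton.1 ha
    -- An equation `a z = f b` is a syzygy of `(f, z)`, an ideal containing powers of both
    -- coordinates. It is therefore Koszul, and `f` divides `a`.
    obtain ⟨c, -, hc⟩ := exists_eq_mul_of_syzygy hn hm
      (mem_nonZeroDivisors_of_ne_zero (pow_ne_zero _ (X_ne_zero_planeRing _)))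
      (X_zero_pow_dvd_of_dvd_mul n m) (α := -b) (β := a) (by linear_combination hb)
    rw [Ideal.Quotient.eq_zero_iff_mem, hc]
    exact neg_mem (Ideal.mul_mem_left _ _ (Ideal.mem_span_singleton_self _))
  · have := finiteDimensional_residue_quotient k (Ideal.span {f})
    refine finiteDimensional_quotient_of_prime k _ fun P hP' hzP => ?_
    have h1 := hP (P.comap (Ideal.Quotient.mk _)) inferInstance
      (by rw [Ideal.mem_comap, Ideal.Quotient.eq_zero_iff_mem.2 (Ideal.mem_span_singleton_self _)]
          exact P.zero_mem)
      (Ideal.mem_comap.2 ((Ideal.span_singleton_le_iff_mem _).1 hzP))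
    rw [← comap_maximalIdeal_quotient (Ideal.span {f})] at h1
    exact Ideal.comap_injective_of_surjective _ Ideal.Quotient.mk_surjective h1

end PlaneRing

/-! ### Derivations of `k[[x, y]][[t]]` and the chain rule -/

section PowerSeriesOverPlane

variable {k : Type*} [Field k]

theorem algebraMap_powerSeries_X :
    algebraMap (PowerSeries k) (PowerSeries (PlaneRing k)) PowerSeries.X = PowerSeries.X := by
  rw [PowerSeries.algebraMap_apply'', PowerSeries.map_X]

theorem powerSeries_eq_const_add (b : PowerSeries (PlaneRing k)) :
    ∃ (c : k) (b₁ b₂ b₃ : PowerSeries (PlaneRing k)),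
      b = algebraMap k _ c + PowerSeries.C (MvPowerSeries.X 0) * b₁ +
        PowerSeries.C (MvPowerSeries.X 1) * b₂ + PowerSeries.X * b₃ := by
  obtain ⟨r₁, r₂, h⟩ := planeRing_eq_const_add (PowerSeries.constantCoeff b)
  refine ⟨MvPowerSeries.constantCoeff (PowerSeries.constantCoeff b), PowerSeries.C r₁, PowerSeries.C r₂,
    PowerSeries.mk fun n => PowerSeries.coeff (n + 1) b, ?_⟩
  conv_lhs => rw [PowerSeries.eq_X_mul_shift_add_const b, h, map_add, map_add, map_mul, map_mul]
  rw [add_comm, PowerSeries.algebraMap_apply]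

theorem maximalIdeal_powerSeries_planeRing :
    IsLocalRing.maximalIdeal (PowerSeries (PlaneRing k)) =
      Ideal.span {PowerSeries.C (MvPowerSeries.X 0), PowerSeries.C (MvPowerSeries.X 1),
        PowerSeries.X} := by
  have hle : Ideal.span {PowerSeries.C (MvPowerSeries.X 0), PowerSeries.C (MvPowerSeries.X 1),
        PowerSeries.X} ≤ IsLocalRing.maximalIdeal (PowerSeries (PlaneRing k)) := by
    refine Ideal.span_le.2 ?_
    rintro _ (rfl | rfl | rfl) <;>
    · refine (IsLocalRing.mem_maximalIdeal _).2 fun h => ?_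
      simpa using (h.map PowerSeries.constantCoeff).map MvPowerSeries.constantCoeff
  refine le_antisymm (fun b hb => ?_) hle
  obtain ⟨c, b₁, b₂, b₃, h⟩ := powerSeries_eq_const_add b
  have h1 : PowerSeries.C (MvPowerSeries.X 0) * b₁ +
      PowerSeries.C (MvPowerSeries.X 1) * b₂ + PowerSeries.X * b₃ ∈ Ideal.span {PowerSeries.C
        (MvPowerSeries.X 0 : PlaneRing k), PowerSeries.C (MvPowerSeries.X 1), PowerSeries.X} :=
    Ideal.add_mem _ (Ideal.add_mem _ (Ideal.mul_mem_right _ _ (Ideal.subset_span (by simp)))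
      (Ideal.mul_mem_right _ _ (Ideal.subset_span (by simp))))
      (Ideal.mul_mem_right _ _ (Ideal.subset_span (by simp)))
  rw [h, add_assoc, add_assoc, ← add_assoc (_ * b₁)] at hb ⊢
  rcases eq_or_ne c 0 with rfl | hc
  · rwa [map_zero, zero_add]
  · have h2 := (Ideal.add_mem_iff_left _ (hle h1)).1 hb
    exact absurd ((IsUnit.mk0 c hc).map (algebraMap k _)) ((IsLocalRing.mem_maximalIdeal _).1 h2)

/-- A derivation of `k[[x, y]][[t]]` into a finite module that kills `k`, `x`, `y` and `t`
vanishes. -/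
theorem derivation_eq_zero {M : Type*} [AddCommGroup M] [Module (PowerSeries (PlaneRing k)) M]
    [Module.Finite (PowerSeries (PlaneRing k)) M] (D : PowerSeries (PlaneRing k) →+ M)
    (hD : ∀ a b, D (a * b) = a • D b + b • D a) (hk : ∀ c : k, D (algebraMap k _ c) = 0)
    (hx : D (PowerSeries.C (MvPowerSeries.X 0)) = 0)
    (hy : D (PowerSeries.C (MvPowerSeries.X 1)) = 0) (ht : D PowerSeries.X = 0) : D = 0 := by
  -- No continuity of `D` is assumed. Each splitting `b = c + x b₁ + y b₂ + t b₃` gains one power of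
  -- the maximal ideal, and Krull's intersection theorem applies because `M` is finite.
  suffices H : ∀ (n : ℕ) b, D b ∈
      IsLocalRing.maximalIdeal (PowerSeries (PlaneRing k)) ^ n • (⊤ : Submodule _ M) by
    ext b
    have h1 : D b ∈ (⨅ i : ℕ, IsLocalRing.maximalIdeal (PowerSeries (PlaneRing k)) ^ i • ⊤ :
        Submodule (PowerSeries (PlaneRing k)) M) := (Submodule.mem_iInf _).2 fun n => H n b
    rw [Ideal.iInf_pow_smul_eq_bot_of_isLocalRing _ (Ideal.IsPrime.ne_top inferInstance)] at h1
    exact h1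
  intro n
  induction n with
  | zero => intro b; simp
  | succ n ih =>
    intro b
    obtain ⟨c, b₁, b₂, b₃, h⟩ := powerSeries_eq_const_add b
    rw [h, map_add, map_add, map_add, hD, hD, hD, hk, hx, hy, ht, smul_zero, smul_zero, smul_zero,
      zero_add, add_zero, add_zero, add_zero, pow_succ', mul_smul, maximalIdeal_powerSeries_planeRing]
    rw [maximalIdeal_powerSeries_planeRing] at ih
    exact add_mem (add_mem (Submodule.smul_mem_smul (Ideal.subset_span (by simp)) (ih _))
      (Submodule.smul_mem_smul (Ideal.subset_span (by simp)) (ih _)))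
      (Submodule.smul_mem_smul (Ideal.subset_span (by simp)) (ih _))

theorem fiberDeriv_mul (i : Fin 2) (a b : PowerSeries (PlaneRing k)) :
    fiberDeriv i (a * b) = a * fiberDeriv i b + b * fiberDeriv i a := by
  ext1 n
  rw [mul_comm b, map_add]
  simp only [fiberDeriv, PowerSeries.coeff_mk, PowerSeries.coeff_mul, map_sum, Derivation.leibniz,
    ← Finset.sum_add_distrib]
  exact Finset.sum_congr rfl fun x _ => by simp only [smul_eq_mul]; ring

theorem fiberDeriv_algebraMap (i : Fin 2) (c : PowerSeries k) :
    fiberDeriv i (algebraMap _ (PowerSeries (PlaneRing k)) c) = 0 := by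
  ext1 n
  rw [PowerSeries.algebraMap_apply'', fiberDeriv, PowerSeries.coeff_mk, PowerSeries.coeff_map,
    Derivation.map_algebraMap, map_zero]

/-- The coefficientwise partial derivative as a `k[[t]]`-linear derivation. -/
def fiberDerivation (i : Fin 2) :
    Derivation (PowerSeries k) (PowerSeries (PlaneRing k)) (PowerSeries (PlaneRing k)) :=
  Derivation.mk'
    { toFun := fiberDeriv i
      map_add' := fun a b => by ext1 n; simp [fiberDeriv]
      map_smul' := fun c a => by
        rw [Algebra.smul_def, fiberDeriv_mul, fiberDeriv_algebraMap, mul_zero, add_zero,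
          RingHom.id_apply, Algebra.smul_def] }
    (fiberDeriv_mul i)

theorem fiberDerivation_apply (i : Fin 2) (F : PowerSeries (PlaneRing k)) :
    fiberDerivation i F = fiberDeriv i F := rfl

theorem fiberDeriv_C (i : Fin 2) (r : PlaneRing k) :
    fiberDeriv i (PowerSeries.C r) = PowerSeries.C (MvPowerSeries.pderiv k i r) := by
  ext1 n
  rw [fiberDeriv, PowerSeries.coeff_mk, PowerSeries.coeff_C, PowerSeries.coeff_C]
  split_ifs <;> simp

/-- The chain rule for derivations of `k[[x, y]][[t]]` into a finite module. -/
theorem derivation_apply {M : Type*} [AddCommGroup M] [Module (PowerSeries (PlaneRing k)) M]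
    [Module.Finite (PowerSeries (PlaneRing k)) M] (D : PowerSeries (PlaneRing k) →+ M)
    (hD : ∀ a b, D (a * b) = a • D b + b • D a) (hk : ∀ c : k, D (algebraMap k _ c) = 0)
    (b : PowerSeries (PlaneRing k)) :
    D b = fiberDeriv 0 b • D (PowerSeries.C (MvPowerSeries.X 0)) +
      fiberDeriv 1 b • D (PowerSeries.C (MvPowerSeries.X 1)) +
      PowerSeries.derivative (PlaneRing k) b • D PowerSeries.X := by
  set x := PowerSeries.C (MvPowerSeries.X 0 : PlaneRing k) with hx
  set y := PowerSeries.C (MvPowerSeries.X 1 : PlaneRing k) with hy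
  let D' : PowerSeries (PlaneRing k) →+ M :=
    { toFun := fun b => D b - ((fiberDerivation 0 b) • D x + (fiberDerivation 1 b) • D y +
        PowerSeries.derivative (PlaneRing k) b • D PowerSeries.X)
      map_zero' := by simp
      map_add' := fun a b => by simp only [map_add, add_smul]; abel }
  have hD'a : ∀ b, D' b = D b - ((fiberDerivation 0 b) • D x + (fiberDerivation 1 b) • D y +
        PowerSeries.derivative (PlaneRing k) b • D PowerSeries.X) := fun _ => rfl
  have hX : ∀ i j : Fin 2, fiberDerivation i (PowerSeries.C (MvPowerSeries.X j : PlaneRing k)) =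
      if i = j then 1 else 0 := fun i j => by
    rw [fiberDerivation_apply, fiberDeriv_C]
    split_ifs with h
    · rw [h, MvPowerSeries.pderiv_X_self, map_one]
    · rw [MvPowerSeries.pderiv_X_of_ne (Ne.symm h), map_zero]
  have hT : ∀ i, fiberDerivation i (PowerSeries.X : PowerSeries (PlaneRing k)) = 0 := fun i => by
    rw [← algebraMap_powerSeries_X, Derivation.map_algebraMap]
  have h0 : D' = 0 := by
    refine derivation_eq_zero D' (fun a b => ?_) (fun c => ?_) ?_ ?_ ?_
    · rw [hD'a, hD'a, hD'a, hD]
      simp only [Derivation.leibniz, smul_eq_mul, add_smul, mul_smul, smul_sub, smul_add]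
      abel
    · have h1 : (algebraMap k (PowerSeries (PlaneRing k)) c) =
          algebraMap (PowerSeries k) _ (PowerSeries.C c) := by
        rw [PowerSeries.algebraMap_apply'', PowerSeries.map_C, PowerSeries.algebraMap_apply]
      have h2 : PowerSeries.derivative (PlaneRing k) (algebraMap k (PowerSeries (PlaneRing k)) c) = 0 := by
        rw [PowerSeries.algebraMap_apply, PowerSeries.derivative_C]
      rw [hD'a, hk, h2, h1, Derivation.map_algebraMap, Derivation.map_algebraMap]
      simp
    · rw [hD'a, hx, hX, hX, PowerSeries.derivative_C]; simp
    · rw [hD'a, hy, hX, hX, PowerSeries.derivative_C]; simp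
    · rw [hD'a, hT, hT, PowerSeries.derivative_X]; simp
  have := DFunLike.congr_fun h0 b
  exact sub_eq_zero.1 this

end PowerSeriesOverPlane

/-! ### The total space, its special fibre, and admissibility -/

section TotalRing

variable {k : Type*} [Field k] {f : PlaneRing k} {d : ℕ} {δ : Fin d → PlaneRing k} {a : Fin d → k}

theorem constantCoeff_deformationEq :
    PowerSeries.constantCoeff (deformationEq f δ a) = f := by
  simp [deformationEq]

variable (f δ a) in
/-- The coordinate `t` of the base, as an element of `𝒪_X`. -/
def baseParam : TotalRing f δ a := algebraMap (PowerSeries k) (TotalRing f δ a) PowerSeries.X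

theorem baseParam_eq : baseParam f δ a = Ideal.Quotient.mk _ PowerSeries.X := by
  rw [← algebraMap_powerSeries_X]; rfl

theorem specialFiberIdeal_eq : specialFiberIdeal f δ a = Ideal.span {baseParam f δ a} := rfl

variable (f δ a) in
/-- The restriction `𝒪_X → 𝒪_{X₀} = R / (f)` to the special fibre. -/
def restrictSpecial : TotalRing f δ a →ₐ[k] PlaneRing k ⧸ Ideal.span {f} :=
  { Ideal.Quotient.lift (Ideal.span {deformationEq f δ a})
      ((Ideal.Quotient.mk (Ideal.span {f})).comp PowerSeries.constantCoeff) (fun s hs => by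
        obtain ⟨g, rfl⟩ := Ideal.mem_span_singleton.1 hs
        rw [RingHom.comp_apply, map_mul, constantCoeff_deformationEq, Ideal.Quotient.eq_zero_iff_mem]
        exact Ideal.mul_mem_right _ _ (Ideal.mem_span_singleton_self _)) with
    commutes' := fun c => by
      have h : algebraMap k (TotalRing f δ a) c =
          Ideal.Quotient.mk _ (algebraMap k (PowerSeries (PlaneRing k)) c) := rfl
      rw [h, PowerSeries.algebraMap_apply]
      exact congrArg (Ideal.Quotient.mk (Ideal.span {f})) (PowerSeries.constantCoeff_C _) }

theorem restrictSpecial_mk (s : PowerSeries (PlaneRing k)) :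
    restrictSpecial f δ a (Ideal.Quotient.mk _ s) =
      Ideal.Quotient.mk _ (PowerSeries.constantCoeff s) := rfl

variable (f δ a) in
theorem restrictSpecial_surjective : Function.Surjective (restrictSpecial f δ a) := fun r => by
  obtain ⟨r, rfl⟩ := Ideal.Quotient.mk_surjective r
  exact ⟨Ideal.Quotient.mk _ (PowerSeries.C r), by
    rw [restrictSpecial_mk, PowerSeries.constantCoeff_C]⟩

theorem restrictSpecial_eq_zero_iff {x : TotalRing f δ a} :
    restrictSpecial f δ a x = 0 ↔ baseParam f δ a ∣ x := by
  constructor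
  · intro h
    obtain ⟨s, rfl⟩ := Ideal.Quotient.mk_surjective x
    rw [restrictSpecial_mk, Ideal.Quotient.eq_zero_iff_mem, Ideal.mem_span_singleton] at h
    obtain ⟨g, hg⟩ := h
    obtain ⟨s', hs'⟩ : PowerSeries.X ∣ s - deformationEq f δ a * PowerSeries.C g :=
      PowerSeries.X_dvd_iff.2 (by
        rw [map_sub, map_mul, constantCoeff_deformationEq, PowerSeries.constantCoeff_C, hg, sub_self])
    refine ⟨Ideal.Quotient.mk _ s', ?_⟩
    rw [baseParam_eq, ← map_mul, ← hs', Ideal.Quotient.eq, sub_sub_cancel]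
    exact Ideal.mul_mem_right _ _ (Ideal.mem_span_singleton_self _)
  · rintro ⟨y, rfl⟩
    rw [map_mul, baseParam_eq, restrictSpecial_mk, PowerSeries.constantCoeff_X, map_zero, zero_mul]

variable (f δ a) in
theorem restrictSpecial_baseParam : restrictSpecial f δ a (baseParam f δ a) = 0 := by
  rw [baseParam_eq, restrictSpecial_mk, PowerSeries.constantCoeff_X, map_zero]

/-- Flatness over the base: `t s = F g` forces `f` times the constant term of `g` to vanish, so `t`
divides `g`. -/
theorem eq_zero_of_baseParam_mul (hf : f ≠ 0) {x : TotalRing f δ a}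
    (h : baseParam f δ a * x = 0) : x = 0 := by
  obtain ⟨s, rfl⟩ := Ideal.Quotient.mk_surjective x
  rw [baseParam_eq, ← map_mul, Ideal.Quotient.eq_zero_iff_mem, Ideal.mem_span_singleton] at h
  obtain ⟨g, hg⟩ := h
  have h0 := congrArg PowerSeries.constantCoeff hg
  rw [map_mul, map_mul, PowerSeries.constantCoeff_X, zero_mul, constantCoeff_deformationEq,
    eq_comm, mul_eq_zero, or_iff_right hf] at h0
  obtain ⟨g', rfl⟩ := PowerSeries.X_dvd_iff.2 h0
  rw [mul_left_comm] at hg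
  rw [mul_left_cancel₀ PowerSeries.X_ne_zero hg, Ideal.Quotient.eq_zero_iff_mem]
  exact Ideal.mul_mem_right _ _ (Ideal.mem_span_singleton_self _)

theorem baseParam_mem_nonZeroDivisors (hf : f ≠ 0) :
    baseParam f δ a ∈ nonZeroDivisors (TotalRing f δ a) :=
  mem_nonZeroDivisors_iff_left.2 fun _ hx => eq_zero_of_baseParam_mul hf hx

theorem isLocalRing_totalRing (hf : MvPowerSeries.constantCoeff f = 0) :
    IsLocalRing (TotalRing f δ a) :=
  isLocalRing_quotient fun h => by
    rw [Ideal.span_singleton_eq_top] at h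
    have := (h.map PowerSeries.constantCoeff).map MvPowerSeries.constantCoeff
    rw [constantCoeff_deformationEq, hf] at this
    exact not_isUnit_zero this

theorem isLocalRing_curve (hf : MvPowerSeries.constantCoeff f = 0) :
    IsLocalRing (PlaneRing k ⧸ Ideal.span {f}) :=
  isLocalRing_quotient fun h => by
    rw [Ideal.span_singleton_eq_top] at h
    have := h.map MvPowerSeries.constantCoeff
    rw [hf] at this
    exact not_isUnit_zero this

variable (f δ a) in
/-- The quotient by `(t) + I` is a quotient of the ring of the special fibre. -/
def quotientSpecialEquiv (I : Ideal (TotalRing f δ a)) :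
    (TotalRing f δ a ⧸ (specialFiberIdeal f δ a ⊔ I)) ≃ₐ[k]
      (PlaneRing k ⧸ Ideal.span {f}) ⧸ I.map (restrictSpecial f δ a) := by
  let φ := (Ideal.Quotient.mkₐ k (I.map (restrictSpecial f δ a))).comp (restrictSpecial f δ a)
  have hφ : Function.Surjective φ :=
    Ideal.Quotient.mk_surjective.comp (restrictSpecial_surjective f δ a)
  have hker : specialFiberIdeal f δ a ⊔ I = RingHom.ker φ := by
    have h1 : RingHom.ker φ = (I.map (restrictSpecial f δ a)).comap (restrictSpecial f δ a) := by
      ext x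
      exact Ideal.Quotient.eq_zero_iff_mem
    rw [h1, Ideal.comap_map_of_surjective _ (restrictSpecial_surjective f δ a), sup_comm]
    congr 1
    ext x
    rw [Ideal.mem_comap, Ideal.mem_bot, restrictSpecial_eq_zero_iff, specialFiberIdeal_eq,
      Ideal.mem_span_singleton]
  exact (Ideal.quotientEquivAlgOfEq k hker).trans (Ideal.quotientKerAlgEquivOfSurjective hφ)

theorem vdim_eq_finrank {K V : Type*} [Field K] [AddCommGroup V] [Module K V]
    [FiniteDimensional K V] : vdim K V = Module.finrank K V := by
  rw [vdim, ← Module.finrank_eq_rank, map_natCast]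

theorem vdim_eq_top {K V : Type*} [Field K] [AddCommGroup V] [Module K V]
    (h : ¬ FiniteDimensional K V) : vdim K V = ⊤ := by
  rw [vdim, Cardinal.toENat_eq_top]
  by_contra! H
  exact h (Module.rank_lt_aleph0_iff.1 H)

theorem specialMultiplicity_eq (I : Ideal (TotalRing f δ a)) :
    specialMultiplicity f δ a I =
      vdim k ((PlaneRing k ⧸ Ideal.span {f}) ⧸ I.map (restrictSpecial f δ a)) := by
  rw [specialMultiplicity, vdim, vdim, (quotientSpecialEquiv f δ a I).toLinearEquiv.rank_eq]

theorem specialMultiplicity_span_singleton (x : TotalRing f δ a) :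
    specialMultiplicity f δ a (Ideal.span {x}) =
      vdim k ((PlaneRing k ⧸ Ideal.span {f}) ⧸ Ideal.span {restrictSpecial f δ a x}) := by
  rw [specialMultiplicity_eq, Ideal.map_span, Set.image_singleton]

variable (f δ a) in
/-- The partial derivative of the equation of `X`, as an element of `𝒪_X`. -/
def eqDeriv (i : Fin 2) : TotalRing f δ a :=
  Ideal.Quotient.mk _ (fiberDeriv i (deformationEq f δ a))

theorem singIdeal_eq : singIdeal f δ a = Ideal.span {eqDeriv f δ a 0, eqDeriv f δ a 1} := rfl

theorem restrictSpecial_eqDeriv (i : Fin 2) :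
    restrictSpecial f δ a (eqDeriv f δ a i) = Ideal.Quotient.mk _ (MvPowerSeries.pderiv k i f) := by
  rw [eqDeriv, restrictSpecial_mk, ← PowerSeries.coeff_zero_eq_constantCoeff_apply, fiberDeriv,
    PowerSeries.coeff_mk, PowerSeries.coeff_zero_eq_constantCoeff_apply,
    constantCoeff_deformationEq]

theorem map_singIdeal : (singIdeal f δ a).map (restrictSpecial f δ a) = jacobianIdeal f := by
  rw [singIdeal_eq, Ideal.map_span, Set.image_pair, restrictSpecial_eqDeriv,
    restrictSpecial_eqDeriv]
  rfl

theorem IsPlanarICIS.ne_zero (hf : IsPlanarICIS f) : f ≠ 0 := by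
  rintro rfl
  have := hf.isolated
  obtain ⟨n, hn⟩ := exists_pow_mem_of_finiteDimensional k (tjurinaIdeal (0 : PlaneRing k))
    (mem_maximalIdeal_planeRing.2 (MvPowerSeries.constantCoeff_X 0))
  simp only [tjurinaIdeal, map_zero, Set.insert_eq_of_mem, Set.mem_singleton_iff,
    Ideal.span_singleton_zero, Ideal.mem_bot] at hn
  exact X_ne_zero_planeRing 0 (IsReduced.eq_zero _ ⟨n, hn⟩)

theorem tjurinaIdeal_le_comap : tjurinaIdeal f ≤
    (jacobianIdeal f).comap (Ideal.Quotient.mk (Ideal.span {f})) := by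
  rw [tjurinaIdeal, Ideal.span_le]
  rintro _ (rfl | rfl | rfl)
  · rw [SetLike.mem_coe, Ideal.mem_comap,
      Ideal.Quotient.eq_zero_iff_mem.2 (Ideal.mem_span_singleton_self _)]
    exact zero_mem _
  · exact Ideal.subset_span (by simp)
  · exact Ideal.subset_span (by simp)

theorem IsPlanarICIS.finiteDimensional_jacobian (hf : IsPlanarICIS f) :
    FiniteDimensional k ((PlaneRing k ⧸ Ideal.span {f}) ⧸ jacobianIdeal f) := by
  have := hf.isolated
  exact Module.Finite.of_surjective (Ideal.quotientMapₐ (R₁ := k) (I := tjurinaIdeal f)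
    (jacobianIdeal f) (Ideal.Quotient.mkₐ k (Ideal.span {f})) tjurinaIdeal_le_comap).toLinearMap
    (Ideal.quotientMap_surjective (H := tjurinaIdeal_le_comap) Ideal.Quotient.mk_surjective)

/-- Besides existence of the limit, this records the extremal description of `e_f` that is compared
with the automatic degeneracy. -/
theorem IsPlanarICIS.exists_multiplicity [Infinite k] (hf : IsPlanarICIS f) :
    ∃ e : ℕ, HasHilbertSamuelMultiplicity k (jacobianIdeal f) (e : ℝ) ∧
      (∃ h ∈ jacobianIdeal f,
        FiniteDimensional k ((PlaneRing k ⧸ Ideal.span {f}) ⧸ Ideal.span {h}) ∧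
        Module.finrank k ((PlaneRing k ⧸ Ideal.span {f}) ⧸ Ideal.span {h}) = e) ∧
      ∀ h ∈ jacobianIdeal f,
        FiniteDimensional k ((PlaneRing k ⧸ Ideal.span {f}) ⧸ Ideal.span {h}) →
        e ≤ Module.finrank k ((PlaneRing k ⧸ Ideal.span {f}) ⧸ Ideal.span {h}) := by
  have := isLocalRing_curve hf.vanishes
  have := hf.finiteDimensional_jacobian
  obtain ⟨z, hz, hz0, _⟩ := exists_parameter_curve hf.ne_zero
  rw [jacobianIdeal] at this ⊢
  exact exists_hasHilbertSamuelMultiplicity k _ _ hz hz0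

theorem IsPlanarICIS.mem_nonZeroDivisors (hf : IsPlanarICIS f) {h : PlaneRing k ⧸ Ideal.span {f}}
    [FiniteDimensional k ((PlaneRing k ⧸ Ideal.span {f}) ⧸ Ideal.span {h})] :
    h ∈ nonZeroDivisors (PlaneRing k ⧸ Ideal.span {f}) := by
  have := isLocalRing_curve hf.vanishes
  obtain ⟨z, hz, hz0, _⟩ := exists_parameter_curve hf.ne_zero
  exact mem_nonZeroDivisors_of_finiteDimensional k hz hz0

/-- An element of `𝒪_X` whose restriction to the special fibre is regular is regular modulo
all powers of `t`. -/
theorem baseParam_pow_dvd_of_dvd_mul (hf : f ≠ 0) {H : TotalRing f δ a}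
    (hH : restrictSpecial f δ a H ∈ nonZeroDivisors _) (n : ℕ) (x : TotalRing f δ a)
    (h : baseParam f δ a ^ n ∣ H * x) : baseParam f δ a ^ n ∣ x := by
  induction n generalizing x with
  | zero => simp
  | succ n ih =>
    have h1 : restrictSpecial f δ a (H * x) = 0 :=
      restrictSpecial_eq_zero_iff.2 ((dvd_pow_self _ n.succ_ne_zero).trans h)
    rw [map_mul] at h1
    obtain ⟨y, rfl⟩ := restrictSpecial_eq_zero_iff.1 (mem_nonZeroDivisors_iff_left.1 hH _ h1)
    obtain ⟨w, hw⟩ := h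
    rw [pow_succ']
    refine mul_dvd_mul_left _ (ih y ⟨w, ?_⟩)
    refine sub_eq_zero.1 (eq_zero_of_baseParam_mul hf ?_)
    linear_combination hw

theorem comap_maximalIdeal_curve [IsLocalRing (TotalRing f δ a)]
    [IsLocalRing (PlaneRing k ⧸ Ideal.span {f})] :
    (IsLocalRing.maximalIdeal (PlaneRing k ⧸ Ideal.span {f})).comap (restrictSpecial f δ a) =
      IsLocalRing.maximalIdeal (TotalRing f δ a) :=
  IsLocalRing.eq_maximalIdeal (Ideal.comap_isMaximal_of_surjective _ (restrictSpecial_surjective f δ a))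

theorem baseParam_mem_maximalIdeal [IsLocalRing (TotalRing f δ a)]
    [IsLocalRing (PlaneRing k ⧸ Ideal.span {f})] :
    baseParam f δ a ∈ IsLocalRing.maximalIdeal (TotalRing f δ a) := by
  rw [← comap_maximalIdeal_curve, Ideal.mem_comap, restrictSpecial_baseParam]
  exact zero_mem _

/-- A prime of `𝒪_X` through `t` whose restriction has finite colength is maximal. -/
theorem eq_maximalIdeal_of_baseParam_mem [IsLocalRing (TotalRing f δ a)]
    [IsLocalRing (PlaneRing k ⧸ Ideal.span {f})] {I : Ideal (TotalRing f δ a)}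
    [FiniteDimensional k ((PlaneRing k ⧸ Ideal.span {f}) ⧸ I.map (restrictSpecial f δ a))]
    {P : Ideal (TotalRing f δ a)} [P.IsPrime] (ht : baseParam f δ a ∈ P) (hI : I ≤ P) :
    P = IsLocalRing.maximalIdeal (TotalRing f δ a) := by
  refine le_antisymm (IsLocalRing.le_maximalIdeal (Ideal.IsPrime.ne_top inferInstance)) ?_
  intro x hx
  rw [← comap_maximalIdeal_curve, Ideal.mem_comap] at hx
  obtain ⟨n, hn⟩ := exists_pow_mem_of_finiteDimensional k (I.map (restrictSpecial f δ a)) hx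
  rw [← map_pow, Ideal.mem_map_iff_of_surjective _ (restrictSpecial_surjective f δ a)] at hn
  obtain ⟨y, hy, hyx⟩ := hn
  obtain ⟨w, hw⟩ := restrictSpecial_eq_zero_iff.1 (show restrictSpecial f δ a (x ^ n - y) = 0 by
    rw [map_sub, hyx, sub_self])
  refine Ideal.IsPrime.mem_of_pow_mem inferInstance n ?_
  rw [sub_eq_iff_eq_add.1 hw]
  exact add_mem (Ideal.mul_mem_right _ _ ht) (hI hy)

/-- Krull's height theorem for `t` and a lift of a parameter of the special fibre. -/
theorem IsPlanarICIS.height_maximalIdeal_le [IsLocalRing (TotalRing f δ a)] (hf : IsPlanarICIS f) :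
    (IsLocalRing.maximalIdeal (TotalRing f δ a)).height ≤ 2 := by
  have := isLocalRing_curve hf.vanishes
  obtain ⟨z, hz, -, hfin⟩ := exists_parameter_curve hf.ne_zero
  obtain ⟨z, rfl⟩ := restrictSpecial_surjective f δ a z
  have h := Ideal.height_le_card_of_mem_minimalPrimes_span
    (p := IsLocalRing.maximalIdeal (TotalRing f δ a))
    (s := {baseParam f δ a, z}) (Set.toFinite _) ⟨⟨inferInstance, ?_⟩, fun P hP _ => ?_⟩
  · exact h.trans (by exact_mod_cast Set.ncard_insert_le (baseParam f δ a) {z} |>.trans (by simp))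
  · rw [Ideal.span_le]
    rintro _ (rfl | rfl)
    · exact baseParam_mem_maximalIdeal
    · rwa [← comap_maximalIdeal_curve]
  · have := hP.1
    have hfin' : FiniteDimensional k ((PlaneRing k ⧸ Ideal.span {f}) ⧸
        (Ideal.span {z}).map (restrictSpecial f δ a)) := by
      rwa [Ideal.map_span, Set.image_singleton]
    exact (eq_maximalIdeal_of_baseParam_mem (I := Ideal.span {z})
      (hP.2 (Ideal.subset_span (by simp)))
      ((Ideal.span_singleton_le_iff_mem _).2 (hP.2 (Ideal.subset_span (by simp))))).ge

/-- The middle term of the chain is the preimage of a minimal prime of the special fibre. It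
contains the regular element `t`, so is not minimal, and it misses the regular parameter `z`, so is
not maximal. -/
theorem IsPlanarICIS.two_le_height_maximalIdeal [IsLocalRing (TotalRing f δ a)]
    (hf : IsPlanarICIS f) : 2 ≤ (IsLocalRing.maximalIdeal (TotalRing f δ a)).height := by
  have := isLocalRing_curve hf.vanishes
  obtain ⟨z, hz, hz0, -⟩ := exists_parameter_curve hf.ne_zero
  obtain ⟨Q, hQ, hQm⟩ := Ideal.exists_minimalPrimes_le (bot_le (a := IsLocalRing.maximalIdeal
    (PlaneRing k ⧸ Ideal.span {f})))
  have := hQ.1.1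
  have hzQ : z ∉ Q := fun h =>
    (Ideal.disjoint_nonZeroDivisors_of_mem_minimalPrimes hQ).le_bot ⟨h, hz0⟩
  obtain ⟨Q₀, hQ₀, hle⟩ := Ideal.exists_minimalPrimes_le (bot_le (a := Q.comap (restrictSpecial f δ a)))
  have := hQ₀.1.1
  have htQ : baseParam f δ a ∉ Q₀ := fun h =>
    (Ideal.disjoint_nonZeroDivisors_of_mem_minimalPrimes hQ₀).le_bot
      ⟨h, baseParam_mem_nonZeroDivisors hf.ne_zero⟩
  refine two_le_height_of_lt (lt_of_le_of_ne hle ?_) (lt_of_le_of_ne (IsLocalRing.le_maximalIdeal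
    (Ideal.IsPrime.ne_top (inferInstance : (Q.comap (restrictSpecial f δ a)).IsPrime))) ?_)
  · rintro rfl
    refine htQ ?_
    rw [Ideal.mem_comap, restrictSpecial_baseParam]
    exact zero_mem _
  · intro h
    rw [← comap_maximalIdeal_curve] at h
    exact hzQ (Ideal.comap_injective_of_surjective _ (restrictSpecial_surjective f δ a) h ▸ hz)

/-- As `X` has dimension two, codimension two leaves no room for a component of `Sing(X/B)` off the
special fibre. Admissibility is used only through this consequence. -/
theorem IsAdmissible.exists_baseParam_pow_mem (hf : IsPlanarICIS f) (ha : IsAdmissible f δ a) :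
    ∃ n, baseParam f δ a ^ n ∈ singIdeal f δ a := by
  have := isLocalRing_totalRing (δ := δ) (a := a) hf.vanishes
  have := isLocalRing_curve hf.vanishes
  change _ ∈ Ideal.radical _
  rw [Ideal.radical_eq_sInf, Ideal.mem_sInf]
  rintro P ⟨hP, hP'⟩
  by_contra ht
  have h1 : P < IsLocalRing.maximalIdeal (TotalRing f δ a) :=
    lt_of_le_of_ne (IsLocalRing.le_maximalIdeal hP'.ne_top) fun h =>
      ht (h ▸ baseParam_mem_maximalIdeal)
  have h2 := (add_le_add_left (ha.trans (Ideal.height_mono hP)) 1).trans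
    ((Ideal.height_add_one_le_of_lt_of_isPrime h1).trans hf.height_maximalIdeal_le)
  exact absurd h2 (by norm_num)

theorem IsAdmissible.eq_zero_of_mul_eqDeriv (hf : IsPlanarICIS f) (ha : IsAdmissible f δ a)
    {c : TotalRing f δ a} (h0 : c * eqDeriv f δ a 0 = 0) (h1 : c * eqDeriv f δ a 1 = 0) :
    c = 0 := by
  obtain ⟨n, hn⟩ := ha.exists_baseParam_pow_mem hf
  obtain ⟨x, y, hxy⟩ := Ideal.mem_span_pair.1 hn
  refine (mul_right_mem_nonZeroDivisors_eq_zero_iff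
    (pow_mem (baseParam_mem_nonZeroDivisors hf.ne_zero) n)).1 (?_ : c * baseParam f δ a ^ n = 0)
  rw [← hxy]
  change c * (x * eqDeriv f δ a 0 + y * eqDeriv f δ a 1) = 0
  linear_combination x * h0 + y * h1

/-- The regular sequence in `(F_x, F_y)` is `t ^ n` and a lift `H` of an element of `J(f)` of finite
colength, hence regular on the special fibre. -/
theorem IsAdmissible.exists_eq_mul_of_syzygy [Infinite k] (hf : IsPlanarICIS f)
    (ha : IsAdmissible f δ a) {α β : TotalRing f δ a}
    (h : α * eqDeriv f δ a 0 + β * eqDeriv f δ a 1 = 0) :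
    ∃ c, α = c * eqDeriv f δ a 1 ∧ β = -(c * eqDeriv f δ a 0) := by
  obtain ⟨n, hn⟩ := ha.exists_baseParam_pow_mem hf
  obtain ⟨e, -, ⟨g, hg, hfin, -⟩, -⟩ := hf.exists_multiplicity
  rw [← map_singIdeal (δ := δ) (a := a),
    Ideal.mem_map_iff_of_surjective _ (restrictSpecial_surjective f δ a)] at hg
  obtain ⟨H, hH, rfl⟩ := hg
  exact AutDeg.exists_eq_mul_of_syzygy hn hH
    (pow_mem (baseParam_mem_nonZeroDivisors hf.ne_zero) n)
    (baseParam_pow_dvd_of_dvd_mul hf.ne_zero hf.mem_nonZeroDivisors n) h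

end TotalRing

/-! ### The dual of principal parts of order two -/

section PrincipalPartsDual

variable (B : Type*) {O : Type*} [CommRing B] [CommRing O] [Algebra B O]

variable {B} in
/-- The functional on `T / I` induced by a functional on `T` that kills `I`. -/
def liftQuotient {T : Type*} [CommRing T] [Algebra O T] (I : Ideal T) (L : T →ₗ[O] O)
    (h : ∀ x ∈ I, L x = 0) : Module.Dual O (T ⧸ I) :=
  Submodule.liftQ (I.restrictScalars O) L h

theorem liftQuotient_mk {T : Type*} [CommRing T] [Algebra O T] (I : Ideal T) (L : T →ₗ[O] O)
    (h : ∀ x ∈ I, L x = 0) (x : T) : liftQuotient I L h (Ideal.Quotient.mk I x) = L x := rfl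

variable (O) in
/-- The functional induced by multiplication. -/
def mulFunctional : Module.Dual O ((O ⊗[B] O) ⧸ KaehlerDifferential.ideal B O ^ 2) :=
  liftQuotient _ (Algebra.TensorProduct.lmul'' B (S := O)).toLinearMap fun x hx =>
    show x ∈ KaehlerDifferential.ideal B O from Ideal.pow_le_self two_ne_zero hx

variable {B}

theorem mulFunctional_tmul (a b : O) :
    mulFunctional B O (Ideal.Quotient.mk _ (a ⊗ₜ b)) = a * b :=
  liftQuotient_mk _ _ _ _

/-- The functional `a ⊗ b ↦ a D(b)` given by a derivation `D`. -/
def derivationFunctional (D : Derivation B O O) :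
    Module.Dual O ((O ⊗[B] O) ⧸ KaehlerDifferential.ideal B O ^ 2) :=
  liftQuotient _ D.tensorProductTo fun x hx => by
    rw [pow_two] at hx
    refine Submodule.mul_induction_on hx (fun y hy z hz => ?_) fun y z hy hz => by
      rw [map_add, hy, hz, add_zero]
    rw [Derivation.tensorProductTo_mul, RingHom.mem_ker.1 hy, RingHom.mem_ker.1 hz, zero_smul,
      zero_smul, add_zero]

theorem derivationFunctional_tmul (D : Derivation B O O) (a b : O) :
    derivationFunctional D (Ideal.Quotient.mk _ (a ⊗ₜ b)) = a * D b :=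
  liftQuotient_mk _ _ _ _

theorem functional_ext {φ ψ : Module.Dual O ((O ⊗[B] O) ⧸ KaehlerDifferential.ideal B O ^ 2)}
    (h : ∀ b, φ (Ideal.Quotient.mk _ (1 ⊗ₜ b)) = ψ (Ideal.Quotient.mk _ (1 ⊗ₜ b))) : φ = ψ := by
  refine LinearMap.ext fun x => ?_
  obtain ⟨x, rfl⟩ := Ideal.Quotient.mk_surjective x
  induction x using TensorProduct.induction_on with
  | zero => rw [map_zero, map_zero, map_zero]
  | add x y hx hy => rw [map_add, map_add, map_add, hx, hy]
  | tmul a b =>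
    have h1 : Ideal.Quotient.mk (KaehlerDifferential.ideal B O ^ 2) (a ⊗ₜ b) =
        a • Ideal.Quotient.mk (KaehlerDifferential.ideal B O ^ 2) (1 ⊗ₜ[B] b) := by
      rw [show a ⊗ₜ[B] b = a • (1 ⊗ₜ[B] b) by
        rw [TensorProduct.smul_tmul', smul_eq_mul, mul_one]]
      rfl
    rw [h1, map_smul, map_smul, h]

/-- Functionals on principal parts of order two are differential operators of order one. -/
theorem exists_derivation_of_functional
    (φ : Module.Dual O ((O ⊗[B] O) ⧸ KaehlerDifferential.ideal B O ^ 2)) :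
    ∃ D : Derivation B O O,
      φ = φ (Ideal.Quotient.mk _ 1) • mulFunctional B O + derivationFunctional D := by
  let ρ : O →ₗ[B] O :=
    (φ.restrictScalars B).comp ((Ideal.Quotient.mkₐ B (KaehlerDifferential.ideal B O ^ 2)).comp
      (Algebra.TensorProduct.includeRight : O →ₐ[B] O ⊗[B] O)).toLinearMap
  have hρ : ∀ b, ρ b = φ (Ideal.Quotient.mk _ (1 ⊗ₜ b)) := fun b => rfl
  set c := φ (Ideal.Quotient.mk _ 1) with hc
  have hs : ∀ a x, φ (Ideal.Quotient.mk _ ((a ⊗ₜ[B] (1 : O)) * x)) =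
      a * φ (Ideal.Quotient.mk _ x) := fun a x => by
    rw [← smul_eq_mul a, ← map_smul, map_mul]
    congr 1
    rw [Algebra.smul_def]
    rfl
  -- Evaluate `φ` on `(1 ⊗ a - a ⊗ 1)(1 ⊗ b - b ⊗ 1)`, which lies in `I_Δ ^ 2`. The identity says
  -- that `ρ` minus multiplication by `c` is a derivation.
  have hleib : ∀ a b, ρ (a * b) + a * b * c = a * ρ b + b * ρ a := by
    intro a b
    have h1 : ((1 : O) ⊗ₜ[B] a - a ⊗ₜ[B] (1 : O)) * ((1 : O) ⊗ₜ[B] b - b ⊗ₜ[B] (1 : O)) ∈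
        KaehlerDifferential.ideal B O ^ 2 := by
      rw [pow_two]
      exact Ideal.mul_mem_mul (KaehlerDifferential.one_smul_sub_smul_one_mem_ideal B a)
        (KaehlerDifferential.one_smul_sub_smul_one_mem_ideal B b)
    have h2 : ((1 : O) ⊗ₜ[B] a - a ⊗ₜ[B] (1 : O)) * ((1 : O) ⊗ₜ[B] b - b ⊗ₜ[B] (1 : O)) =
        1 ⊗ₜ (a * b) - (a ⊗ₜ 1) * (1 ⊗ₜ b) - (b ⊗ₜ 1) * (1 ⊗ₜ a) + ((a * b) ⊗ₜ 1) * 1 := by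
      simp only [sub_mul, mul_sub, Algebra.TensorProduct.tmul_mul_tmul, one_mul, mul_one]
      abel
    have h3 := congrArg φ (Ideal.Quotient.eq_zero_iff_mem.2 h1)
    rw [h2, map_zero, map_add, map_sub, map_sub, map_add, map_sub, map_sub, hs, hs, hs] at h3
    rw [hρ, hρ, hρ]
    linear_combination h3
  let D : Derivation B O O := Derivation.mk' (ρ - LinearMap.mulRight B c) fun a b => by
    simp only [LinearMap.sub_apply, LinearMap.mulRight_apply, smul_eq_mul]
    linear_combination hleib a b
  refine ⟨D, functional_ext fun b => ?_⟩
  rw [LinearMap.add_apply, LinearMap.smul_apply, mulFunctional_tmul, derivationFunctional_tmul,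
    ← hρ]
  change ρ b = c • (1 * b) + 1 * (ρ b - b * c)
  rw [smul_eq_mul]
  ring

end PrincipalPartsDual

/-! ### The Hamiltonian derivation and the degeneracy ideals -/

section Hamiltonian

variable {k : Type*} [Field k] {f : PlaneRing k} {d : ℕ} {δ : Fin d → PlaneRing k} {a : Fin d → k}

/-- `F_y ∂_x - F_x ∂_y` kills `F`, so it preserves `(F)` and descends to `O_X`. -/
theorem mk_hamiltonian_eq_zero {x : PowerSeries (PlaneRing k)}
    (hx : Ideal.Quotient.mkₐ (PowerSeries k) (Ideal.span {deformationEq f δ a}) x = 0) :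
    Ideal.Quotient.mkₐ (PowerSeries k) (Ideal.span {deformationEq f δ a})
      ((fiberDeriv 1 (deformationEq f δ a) • fiberDerivation 0 -
        fiberDeriv 0 (deformationEq f δ a) • fiberDerivation 1 : Derivation (PowerSeries k) _ _) x) =
      0 := by
  obtain ⟨g, rfl⟩ := Ideal.mem_span_singleton.1 (Ideal.Quotient.eq_zero_iff_mem.1 hx)
  refine Ideal.Quotient.eq_zero_iff_mem.2 (Ideal.mem_span_singleton.2
    ⟨fiberDeriv 1 (deformationEq f δ a) * fiberDeriv 0 g -
      fiberDeriv 0 (deformationEq f δ a) * fiberDeriv 1 g, ?_⟩)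
  rw [Derivation.leibniz]
  simp only [Derivation.sub_apply, Derivation.smul_apply, smul_eq_mul, fiberDerivation_apply]
  ring

variable (f δ a) in
/-- The derivation `F_y ∂_x - F_x ∂_y` of `𝒪_X` over the base. -/
def hamiltonian : Derivation (PowerSeries k) (TotalRing f δ a) (TotalRing f δ a) :=
  Derivation.liftOfSurjective
    (f := Ideal.Quotient.mkₐ (PowerSeries k) (Ideal.span {deformationEq f δ a}))
    Ideal.Quotient.mk_surjective fun _ => mk_hamiltonian_eq_zero

theorem hamiltonian_mk (b : PowerSeries (PlaneRing k)) :
    hamiltonian f δ a (Ideal.Quotient.mk _ b) =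
      eqDeriv f δ a 1 * Ideal.Quotient.mk _ (fiberDeriv 0 b) -
        eqDeriv f δ a 0 * Ideal.Quotient.mk _ (fiberDeriv 1 b) := by
  refine (Derivation.liftOfSurjective_apply
    (f := Ideal.Quotient.mkₐ (PowerSeries k) (Ideal.span {deformationEq f δ a}))
    Ideal.Quotient.mk_surjective (fun _ => mk_hamiltonian_eq_zero) b).trans ?_
  rw [eqDeriv, eqDeriv, ← map_mul, ← map_mul, ← map_sub]
  rfl

variable (f δ a) in
/-- The coordinates `x` and `y` in `𝒪_X`. -/
def coord (i : Fin 2) : TotalRing f δ a :=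
  Ideal.Quotient.mk _ (PowerSeries.C (MvPowerSeries.X i))

theorem hamiltonian_coord_zero : hamiltonian f δ a (coord f δ a 0) = eqDeriv f δ a 1 := by
  rw [coord, hamiltonian_mk, fiberDeriv_C, fiberDeriv_C, MvPowerSeries.pderiv_X_self,
    MvPowerSeries.pderiv_X_of_ne (by decide)]
  simp

theorem hamiltonian_coord_one : hamiltonian f δ a (coord f δ a 1) = -eqDeriv f δ a 0 := by
  rw [coord, hamiltonian_mk, fiberDeriv_C, fiberDeriv_C, MvPowerSeries.pderiv_X_self,
    MvPowerSeries.pderiv_X_of_ne (by decide)]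
  simp

theorem hamiltonian_mem (x : TotalRing f δ a) : hamiltonian f δ a x ∈ singIdeal f δ a := by
  obtain ⟨b, rfl⟩ := Ideal.Quotient.mk_surjective x
  rw [hamiltonian_mk, singIdeal_eq]
  exact sub_mem (Ideal.mul_mem_right _ _ (Ideal.subset_span (by simp)))
    (Ideal.mul_mem_right _ _ (Ideal.subset_span (by simp)))

theorem derivation_totalRing_mk
    (D : Derivation (PowerSeries k) (TotalRing f δ a) (TotalRing f δ a))
    (b : PowerSeries (PlaneRing k)) :
    D (Ideal.Quotient.mk _ b) = Ideal.Quotient.mk _ (fiberDeriv 0 b) * D (coord f δ a 0) +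
      Ideal.Quotient.mk _ (fiberDeriv 1 b) * D (coord f δ a 1) := by
  let D' : PowerSeries (PlaneRing k) →+ TotalRing f δ a :=
    (D : TotalRing f δ a →ₗ[PowerSeries k] TotalRing f δ a).toAddMonoidHom.comp
      (Ideal.Quotient.mk (Ideal.span {deformationEq f δ a})).toAddMonoidHom
  have hD' : ∀ b, D' b = D (Ideal.Quotient.mk _ b) := fun _ => rfl
  have h := derivation_apply D' (fun x y => by
      rw [hD', hD', hD', map_mul, Derivation.leibniz]; rfl) (fun c => by
      rw [hD', PowerSeries.algebraMap_apply]
      have : (Ideal.Quotient.mk (Ideal.span {deformationEq f δ a})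
          (PowerSeries.C (algebraMap k (PlaneRing k) c))) =
          algebraMap (PowerSeries k) (TotalRing f δ a) (PowerSeries.C c) := by
        rw [← PowerSeries.map_C]; rfl
      rw [this, Derivation.map_algebraMap]) b
  have ht : D' PowerSeries.X = 0 := by
    rw [hD', ← baseParam_eq, baseParam, Derivation.map_algebraMap]
  rw [ht, smul_zero, add_zero] at h
  exact h

/-- Applying `D` to `F = 0` gives `F_x Dx + F_y Dy = 0`, with no `t`-term since `D` is
`k[[t]]`-linear; such a syzygy is Koszul. -/
theorem IsAdmissible.exists_smul_hamiltonian [Infinite k] (hf : IsPlanarICIS f)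
    (ha : IsAdmissible f δ a)
    (D : Derivation (PowerSeries k) (TotalRing f δ a) (TotalRing f δ a)) :
    ∃ c : TotalRing f δ a, D = c • hamiltonian f δ a := by
  have h0 := derivation_totalRing_mk D (deformationEq f δ a)
  rw [Ideal.Quotient.eq_zero_iff_mem.2 (Ideal.mem_span_singleton_self _), map_zero] at h0
  obtain ⟨c, h1, h2⟩ := ha.exists_eq_mul_of_syzygy hf (α := D (coord f δ a 0))
    (β := D (coord f δ a 1)) (by rw [eqDeriv, eqDeriv]; linear_combination -h0)
  refine ⟨c, Derivation.ext fun x => ?_⟩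
  obtain ⟨b, rfl⟩ := Ideal.Quotient.mk_surjective x
  rw [derivation_totalRing_mk, h1, h2, Derivation.smul_apply, hamiltonian_mk, smul_eq_mul]
  ring

/-- For an admissible deformation, the dual of the module of principal parts of order two is free
on the multiplication and the Hamiltonian derivation. -/
def dualBasis [Infinite k] (hf : IsPlanarICIS f) (ha : IsAdmissible f δ a) :
    Module.Basis (Fin 2) (TotalRing f δ a)
      (Module.Dual (TotalRing f δ a) (PrincipalParts f δ a 2)) :=
  Module.Basis.mk (v := ![mulFunctional (PowerSeries k) (TotalRing f δ a),
      derivationFunctional (hamiltonian f δ a)])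
    (LinearIndependent.pair_iff.2 fun s t h => by
      have h1 : ∀ b, s * b + t * hamiltonian f δ a b = 0 := fun b => by
        have := LinearMap.congr_fun h (Ideal.Quotient.mk _ (1 ⊗ₜ b))
        rw [LinearMap.add_apply, LinearMap.smul_apply, LinearMap.smul_apply, mulFunctional_tmul,
          derivationFunctional_tmul, one_mul, one_mul] at this
        exact this
      have hs : s = 0 := by
        have := h1 1
        rwa [Derivation.map_one_eq_zero, mul_zero, add_zero, mul_one] at this
      subst hs
      refine ⟨rfl, ha.eq_zero_of_mul_eqDeriv hf ?_ ?_⟩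
      · have := h1 (coord f δ a 1)
        rw [hamiltonian_coord_one] at this
        linear_combination -this
      · have := h1 (coord f δ a 0)
        rwa [hamiltonian_coord_zero, zero_mul, zero_add] at this)
    (fun φ _ => by
      obtain ⟨D, hD⟩ := exists_derivation_of_functional φ
      obtain ⟨c, rfl⟩ := ha.exists_smul_hamiltonian hf D
      rw [Matrix.range_cons, Matrix.range_cons, Matrix.range_empty, Set.union_empty,
        Set.singleton_union, Submodule.mem_span_pair]
      have h : c • derivationFunctional (hamiltonian f δ a) =
          derivationFunctional (c • hamiltonian f δ a) := functional_ext fun b => by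
        rw [LinearMap.smul_apply, derivationFunctional_tmul, derivationFunctional_tmul,
          Derivation.smul_apply, one_mul, one_mul]
      exact ⟨_, c, (congrArg _ h).trans hD.symm⟩)

theorem dualBasis_zero [Infinite k] (hf : IsPlanarICIS f) (ha : IsAdmissible f δ a) :
    dualBasis hf ha 0 = mulFunctional (PowerSeries k) (TotalRing f δ a) := by
  simp [dualBasis]

theorem dualBasis_one [Infinite k] (hf : IsPlanarICIS f) (ha : IsAdmissible f δ a) :
    dualBasis hf ha 1 = derivationFunctional (hamiltonian f δ a) := by
  simp [dualBasis]

theorem derivationFunctional_hamiltonian_mem (x : PrincipalParts f δ a 2) :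
    derivationFunctional (hamiltonian f δ a) x ∈ singIdeal f δ a := by
  obtain ⟨x, rfl⟩ := Ideal.Quotient.mk_surjective x
  induction x using TensorProduct.induction_on with
  | zero => rw [map_zero, map_zero]; exact zero_mem _
  | add x y hx hy => rw [map_add, map_add]; exact add_mem hx hy
  | tmul x y =>
    rw [derivationFunctional_tmul]
    exact Ideal.mul_mem_left _ _ (hamiltonian_mem y)

/-- The degeneracy ideal of a list of principal parts does not depend on the basis. -/
theorem degeneracyIdeal_eq_of_basis {m : ℕ}
    (b e : Module.Basis (Fin m) (TotalRing f δ a)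
      (Module.Dual (TotalRing f δ a) (PrincipalParts f δ a m)))
    (τ : Fin m → PrincipalParts f δ a m) :
    degeneracyIdeal f δ a e τ = degeneracyIdeal f δ a b τ := by
  have h1 : (Matrix.of fun i j => e i (τ j)) =
      (b.toMatrix e).transpose * Matrix.of fun i j => b i (τ j) := by
    ext i j
    rw [Matrix.mul_apply, Matrix.of_apply]
    conv_lhs => rw [← b.sum_repr (e i)]
    rw [LinearMap.sum_apply]
    rfl
  have h2 : IsUnit (b.toMatrix e).det := by
    have := congrArg Matrix.det (b.toMatrix_mul_toMatrix_flip e)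
    rw [Matrix.det_mul, Matrix.det_one] at this
    exact IsUnit.of_mul_eq_one _ this
  rw [degeneracyIdeal, degeneracyIdeal, h1, Matrix.det_mul, Matrix.det_transpose,
    Ideal.span_singleton_mul_left_unit h2]

/-- Expand the determinant along the row of the Hamiltonian, whose values lie in `(F_x, F_y)`. -/
theorem IsAdmissible.exists_degeneracyIdeal_eq [Infinite k] (hf : IsPlanarICIS f)
    (ha : IsAdmissible f δ a)
    (e : Module.Basis (Fin 2) (TotalRing f δ a)
      (Module.Dual (TotalRing f δ a) (PrincipalParts f δ a 2)))
    (τ : Fin 2 → PrincipalParts f δ a 2) :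
    ∃ h ∈ singIdeal f δ a, degeneracyIdeal f δ a e τ = Ideal.span {h} := by
  rw [degeneracyIdeal_eq_of_basis (dualBasis hf ha)]
  refine ⟨_, ?_, rfl⟩
  rw [Matrix.det_fin_two]
  simp only [Matrix.of_apply, dualBasis_zero, dualBasis_one]
  exact sub_mem (Ideal.mul_mem_left _ _ (derivationFunctional_hamiltonian_mem _))
    (Ideal.mul_mem_left _ _ (derivationFunctional_hamiltonian_mem _))

theorem IsAdmissible.exists_degeneracyIdeal_eq_span [Infinite k] (hf : IsPlanarICIS f)
    (ha : IsAdmissible f δ a)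
    (e : Module.Basis (Fin 2) (TotalRing f δ a)
      (Module.Dual (TotalRing f δ a) (PrincipalParts f δ a 2)))
    {h : TotalRing f δ a} (hh : h ∈ singIdeal f δ a) :
    ∃ τ : Fin 2 → PrincipalParts f δ a 2, degeneracyIdeal f δ a e τ = Ideal.span {h} := by
  obtain ⟨α, β, rfl⟩ := Ideal.mem_span_pair.1 hh
  -- The first principal part has column `(1, 0)`, so the determinant is the Hamiltonian value of `β
  -- x - α y`, namely `β F_y + α F_x`.
  refine ⟨![Ideal.Quotient.mk _ (1 ⊗ₜ 1), Ideal.Quotient.mk _ (β ⊗ₜ coord f δ a 0 -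
    α ⊗ₜ coord f δ a 1)], ?_⟩
  rw [degeneracyIdeal_eq_of_basis (dualBasis hf ha), degeneracyIdeal, Matrix.det_fin_two]
  simp only [Matrix.of_apply, dualBasis_zero, dualBasis_one, Matrix.cons_val_zero,
    Matrix.cons_val_one, map_sub, mulFunctional_tmul, derivationFunctional_tmul,
    Derivation.map_one_eq_zero, hamiltonian_coord_zero, hamiltonian_coord_one]
  congr 2
  change _ = α * eqDeriv f δ a 0 + β * eqDeriv f δ a 1
  ring

end Hamiltonian

/-! ### Local algebras over `k[[t]]` and extension of `d/dt` -/

section BaseAlgebras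

variable (k : Type*) [Field k] (A : Type*) [CommRing A] [Algebra k A] [Algebra (PowerSeries k) A]
  [IsScalarTower k (PowerSeries k) A]

theorem C_smul_eq_smul (c : k) (x : A) : (PowerSeries.C c : PowerSeries k) • x = c • x := by
  rw [← algebraMap_smul (PowerSeries k) c x, PowerSeries.algebraMap_apply]; rfl

/-- If `A / tA` is finite-dimensional, representatives of a basis span the separated
`k[[t]]`-algebra `A`. -/
theorem exists_span_eq_top [IsLocalRing A] [IsNoetherianRing A]
    (ht : algebraMap (PowerSeries k) A PowerSeries.X ∈ IsLocalRing.maximalIdeal A)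
    [FiniteDimensional k (A ⧸ Ideal.span {algebraMap (PowerSeries k) A PowerSeries.X})] :
    ∃ v : Fin (Module.finrank k (A ⧸ Ideal.span {algebraMap (PowerSeries k) A PowerSeries.X})) → A,
      Submodule.span (PowerSeries k) (Set.range v) = ⊤ ∧
      ∀ c : _ → k, ∀ y : A, ∑ i, (PowerSeries.C (c i) : PowerSeries k) • v i =
        (PowerSeries.X : PowerSeries k) • y → c = 0 := by
  set t := algebraMap (PowerSeries k) A PowerSeries.X
  have htdef : ∀ (n : ℕ) (y : A), (PowerSeries.X : PowerSeries k) ^ n • y = t ^ n * y :=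
    fun n y => by rw [Algebra.smul_def, map_pow]
  let b := Module.finBasis k (A ⧸ Ideal.span {t})
  choose v hv using fun i => Ideal.Quotient.mk_surjective (b i)
  have hsum : ∀ c : _ → k, Ideal.Quotient.mk (Ideal.span {t})
      (∑ i, (PowerSeries.C (c i) : PowerSeries k) • v i) = ∑ i, c i • b i := fun c => by
    rw [map_sum]
    refine Finset.sum_congr rfl fun i _ => ?_
    rw [C_smul_eq_smul, ← hv]
    rfl
  refine ⟨v, span_eq_top_of_separated v (fun x hx => ?_) fun x => ?_, fun c y h => ?_⟩
  · have h1 := Ideal.iInf_pow_eq_bot_of_isLocalRing (Ideal.span {t}) fun h =>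
      (IsLocalRing.mem_maximalIdeal _).1 ht (Ideal.span_singleton_eq_top.1 h)
    rw [← Ideal.mem_bot, ← h1, Ideal.mem_iInf]
    intro n
    obtain ⟨y, rfl⟩ := hx n
    rw [htdef, Ideal.span_singleton_pow]
    exact Ideal.mul_mem_right _ _ (Ideal.mem_span_singleton_self _)
  · have h1 := hsum fun i => b.repr (Ideal.Quotient.mk _ x) i
    rw [b.sum_repr, eq_comm, Ideal.Quotient.eq, Ideal.mem_span_singleton] at h1
    obtain ⟨y, hy⟩ := h1
    refine ⟨fun i => b.repr (Ideal.Quotient.mk _ x) i, y, ?_⟩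
    rw [← pow_one (PowerSeries.X : PowerSeries k), htdef, pow_one, ← hy]
    ring
  · have h1 := hsum c
    rw [h, ← pow_one (PowerSeries.X : PowerSeries k), htdef, pow_one,
      Ideal.Quotient.eq_zero_iff_mem.2 (Ideal.mul_mem_right _ _ (Ideal.mem_span_singleton_self _)),
      eq_comm] at h1
    exact funext (Fintype.linearIndependent_iff.1 b.linearIndependent c h1)

theorem finite_of_finiteDimensional_quotient [IsLocalRing A] [IsNoetherianRing A]
    (ht : algebraMap (PowerSeries k) A PowerSeries.X ∈ IsLocalRing.maximalIdeal A)
    [FiniteDimensional k (A ⧸ Ideal.span {algebraMap (PowerSeries k) A PowerSeries.X})] :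
    Module.Finite (PowerSeries k) A := by
  obtain ⟨v, hv, -⟩ := exists_span_eq_top k A ht
  exact ⟨hv ▸ Submodule.fg_span (Set.finite_range v)⟩

theorem exists_basis_of_finiteDimensional_quotient [IsLocalRing A] [IsNoetherianRing A]
    (ht : algebraMap (PowerSeries k) A PowerSeries.X ∈ IsLocalRing.maximalIdeal A)
    (htf : ∀ x : A, (PowerSeries.X : PowerSeries k) • x = 0 → x = 0)
    [FiniteDimensional k (A ⧸ Ideal.span {algebraMap (PowerSeries k) A PowerSeries.X})] :
    Nonempty (Module.Basis (Fin (Module.finrank k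
      (A ⧸ Ideal.span {algebraMap (PowerSeries k) A PowerSeries.X}))) (PowerSeries k) A) := by
  obtain ⟨v, hv, hv'⟩ := exists_span_eq_top k A ht
  exact ⟨Module.Basis.mk (linearIndependent_of_torsionFree v htf hv') hv.ge⟩

theorem faithfulSMul_of_torsionFree [IsLocalRing A]
    (ht : algebraMap (PowerSeries k) A PowerSeries.X ∈ IsLocalRing.maximalIdeal A)
    (htf : ∀ x : A, (PowerSeries.X : PowerSeries k) • x = 0 → x = 0) :
    FaithfulSMul (PowerSeries k) A := by
  have h := linearIndependent_of_torsionFree (k := k) (fun _ : Unit => (1 : A)) htf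
    fun c y h => funext fun i => by
      rw [Finset.univ_unique, Finset.sum_singleton, C_smul_eq_smul, Algebra.smul_def,
        Algebra.smul_def, mul_one] at h
      by_contra hc
      have h1 : IsUnit (algebraMap (PowerSeries k) A PowerSeries.X * y) :=
        h ▸ (IsUnit.mk0 _ hc).map (algebraMap k A)
      exact (IsLocalRing.mem_maximalIdeal _).1 ht (isUnit_of_mul_isUnit_left h1)
  rw [faithfulSMul_iff_algebraMap_injective, injective_iff_map_eq_zero]
  intro c hc
  refine Fintype.linearIndependent_iff.1 h (fun _ => c) ?_ ()
  rw [Finset.univ_unique, Finset.sum_singleton, Algebra.smul_def, hc, zero_mul]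

/-- In characteristic zero, the derivation `d/dt` of `k[[t]]` extends to the fraction field of a
finite extension `A`; on `A` it takes values in a finite module. -/
theorem exists_derivation_extending [CharZero k] [IsDomain A] [FaithfulSMul (PowerSeries k) A]
    [Module.Finite (PowerSeries k) A] :
    ∃ (M : Submodule A (FractionRing A)) (D : A →+ M), M.FG ∧
      (∀ x y, D (x * y) = x • D y + y • D x) ∧ (∀ c : k, D (algebraMap k A c) = 0) ∧
      (D (algebraMap (PowerSeries k) A PowerSeries.X) : FractionRing A) = 1 := by
  let B := PowerSeries k
  let K := FractionRing B
  let L := FractionRing A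
  let _ : Algebra K L := FractionRing.liftAlgebra B L
  have : IsScalarTower B K L := FractionRing.isScalarTower_liftAlgebra B L
  have : CharZero K := charZero_of_injective_algebraMap (algebraMap k K).injective
  have : Algebra.IsAlgebraic B L := (IsFractionRing.isAlgebraic_iff' B A L).1 inferInstance
  have : Algebra.IsAlgebraic K L := ⟨fun _ => (IsFractionRing.isAlgebraic_iff B K L).1
    (Algebra.IsAlgebraic.isAlgebraic _)⟩
  -- Characteristic zero makes the algebraic extension `L / K` separable. Then `L` is formally étale
  -- over `B`, so `Ω_L = L ⊗ Ω_B` and `d/dt` extends to `L`.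
  have : Algebra.FormallyEtale K L := Algebra.FormallyEtale.of_isSeparable K L
  have : Algebra.FormallyEtale B K := Algebra.FormallyEtale.of_isLocalization (nonZeroDivisors B)
  have : Algebra.FormallyEtale B L := Algebra.FormallyEtale.comp B K L
  have : IsScalarTower k B L := IsScalarTower.of_algebraMap_eq fun c => by
    rw [IsScalarTower.algebraMap_apply k A L, IsScalarTower.algebraMap_apply k B A,
      ← IsScalarTower.algebraMap_apply B A L]
  let D₀ : Derivation k B L := (Algebra.linearMap B L).compDer (PowerSeries.derivative k)
  let D₁ : Derivation k L L :=
    ((D₀.liftKaehlerDifferential.liftBaseChange L).comp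
      (KaehlerDifferential.tensorKaehlerEquivOfFormallyEtale k B L).symm.toLinearMap).compDer
      (KaehlerDifferential.D k L)
  have hD₁ : ∀ c : B, D₁ (algebraMap B L c) = algebraMap B L (PowerSeries.derivative k c) := by
    intro c
    change D₀.liftKaehlerDifferential.liftBaseChange L
      ((KaehlerDifferential.tensorKaehlerEquivOfFormallyEtale k B L).symm
        (KaehlerDifferential.D k L (algebraMap B L c))) = _
    rw [KaehlerDifferential.tensorKaehlerEquivOfFormallyEtale_symm_D_algebraMap,
      LinearMap.liftBaseChange_tmul, one_smul, Derivation.liftKaehlerDifferential_comp_D]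
    rfl
  obtain ⟨s, hs⟩ := Module.Finite.fg_top (R := B) (M := A)
  -- Generators of `A` over `k[[t]]` and their derivatives suffice, because `D (c x) = c D x + c' x`
  -- for `c` in `k[[t]]`. A finite target is needed for the chain rule.
  let M : Submodule A L := Submodule.span A
    (algebraMap A L '' s ∪ (fun x => D₁ (algebraMap A L x)) '' s)
  have hM : ∀ x : A, D₁ (algebraMap A L x) ∈ M := by
    intro x
    have hx : x ∈ Submodule.span B (s : Set A) := hs ▸ Submodule.mem_top
    induction hx using Submodule.span_induction with
    | mem x hx => exact Submodule.subset_span (Or.inr ⟨x, hx, rfl⟩)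
    | zero => rw [map_zero, map_zero]; exact zero_mem _
    | add x y _ _ hx hy => rw [map_add, map_add]; exact add_mem hx hy
    | smul c x hx' hx =>
      have hx1 : algebraMap A L x ∈ M := by
        clear hx
        induction hx' using Submodule.span_induction with
        | mem x hx => exact Submodule.subset_span (Or.inl ⟨x, hx, rfl⟩)
        | zero => rw [map_zero]; exact zero_mem _
        | add x y _ _ hx hy => rw [map_add]; exact add_mem hx hy
        | smul c x _ hx =>
          rw [Algebra.smul_def, map_mul, ← Algebra.smul_def]
          exact M.smul_mem _ hx
      have h2 : D₁ (algebraMap A L (c • x)) =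
          algebraMap B A c • D₁ (algebraMap A L x) +
            algebraMap B A (PowerSeries.derivative k c) • algebraMap A L x := by
        rw [Algebra.smul_def, map_mul, Derivation.leibniz, ← IsScalarTower.algebraMap_apply B A L,
          hD₁, algebraMap_smul, algebraMap_smul, algebraMap_smul, Algebra.smul_def x,
          Algebra.smul_def (algebraMap B A _), ← IsScalarTower.algebraMap_apply B A L,
          mul_comm (algebraMap A L x)]
      rw [h2]
      exact add_mem (M.smul_mem _ hx) (M.smul_mem _ hx1)
  refine ⟨M, { toFun := fun x => ⟨D₁ (algebraMap A L x), hM x⟩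
               map_zero' := Subtype.ext (by
                 change D₁ (algebraMap A L 0) = 0
                 rw [map_zero, map_zero])
               map_add' := fun x y => Subtype.ext (by
                 change D₁ (algebraMap A L (x + y)) = D₁ (algebraMap A L x) + D₁ (algebraMap A L y)
                 rw [map_add, map_add]) },
    Submodule.fg_span ((s.finite_toSet.image _).union (s.finite_toSet.image _)),
    fun x y => Subtype.ext ?_, fun c => Subtype.ext ?_, ?_⟩
  · change D₁ (algebraMap A L (x * y)) = x • D₁ (algebraMap A L y) + y • D₁ (algebraMap A L x)
    rw [map_mul, Derivation.leibniz, algebraMap_smul, algebraMap_smul]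
  · change D₁ (algebraMap A L (algebraMap k A c)) = 0
    rw [← IsScalarTower.algebraMap_apply k A L, Derivation.map_algebraMap]
  · change D₁ (algebraMap A L (algebraMap B A PowerSeries.X)) = 1
    rw [← IsScalarTower.algebraMap_apply B A L, hD₁, PowerSeries.derivative_X, map_one]

end BaseAlgebras

/-! ### Quotients of a local `k[[t]]`-algebra -/

section Quotients

theorem algebraMap_quotient_X_mem (k : Type*) [Field k] {O : Type*} [CommRing O] [IsLocalRing O]
    [Algebra (PowerSeries k) O] {I : Ideal O} [IsLocalRing (O ⧸ I)]
    (ht : algebraMap (PowerSeries k) O PowerSeries.X ∈ IsLocalRing.maximalIdeal O) :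
    algebraMap (PowerSeries k) (O ⧸ I) PowerSeries.X ∈ IsLocalRing.maximalIdeal (O ⧸ I) := by
  rw [← comap_maximalIdeal_quotient I] at ht
  exact ht

variable (k : Type*) [Field k] {O : Type*} [CommRing O] [IsLocalRing O] [IsNoetherianRing O]
  [Algebra k O] [Algebra (PowerSeries k) O] [IsScalarTower k (PowerSeries k) O]

/-- The special fibre of `O / I` over `k[[t]]` is `O / ((t) + I)`. -/
def quotientBaseEquiv (I : Ideal O) :
    ((O ⧸ I) ⧸ Ideal.span {algebraMap (PowerSeries k) (O ⧸ I) PowerSeries.X}) ≃ₐ[k]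
      O ⧸ (Ideal.span {algebraMap (PowerSeries k) O PowerSeries.X} ⊔ I) :=
  ((Ideal.quotientEquivAlgOfEq k (by
    rw [Ideal.map_span, Set.image_singleton]; rfl)).trans
    (DoubleQuot.quotQuotEquivQuotSupₐ k I
      (Ideal.span {algebraMap (PowerSeries k) O PowerSeries.X}))).trans
    (Ideal.quotientEquivAlgOfEq k (sup_comm _ _))

theorem exists_basis_quotient {I : Ideal O} (hI : I ≠ ⊤)
    (ht : algebraMap (PowerSeries k) O PowerSeries.X ∈ IsLocalRing.maximalIdeal O)
    (htf : ∀ x : O, algebraMap (PowerSeries k) O PowerSeries.X * x ∈ I → x ∈ I)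
    (hfin : FiniteDimensional k
      (O ⧸ (Ideal.span {algebraMap (PowerSeries k) O PowerSeries.X} ⊔ I))) :
    Nonempty (Module.Basis (Fin (Module.finrank k
      (O ⧸ (Ideal.span {algebraMap (PowerSeries k) O PowerSeries.X} ⊔ I))))
      (PowerSeries k) (O ⧸ I)) := by
  have := isLocalRing_quotient hI
  have : FiniteDimensional k
      ((O ⧸ I) ⧸ Ideal.span {algebraMap (PowerSeries k) (O ⧸ I) PowerSeries.X}) :=
    Module.Finite.equiv (quotientBaseEquiv k I).symm.toLinearEquiv
  obtain ⟨b⟩ := exists_basis_of_finiteDimensional_quotient k (O ⧸ I)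
    (algebraMap_quotient_X_mem k ht) fun x hx => by
      obtain ⟨x, rfl⟩ := Ideal.Quotient.mk_surjective x
      refine Ideal.Quotient.eq_zero_iff_mem.2 (htf x (Ideal.Quotient.eq_zero_iff_mem.1 ?_))
      rwa [Algebra.smul_def] at hx
  exact ⟨b.reindex (finCongr (quotientBaseEquiv k I).toLinearEquiv.finrank_eq)⟩

theorem exists_derivation_quotient [CharZero k] {P : Ideal O} [P.IsPrime]
    (ht : algebraMap (PowerSeries k) O PowerSeries.X ∈ IsLocalRing.maximalIdeal O)
    (htP : algebraMap (PowerSeries k) O PowerSeries.X ∉ P)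
    (hfin : FiniteDimensional k
      (O ⧸ (Ideal.span {algebraMap (PowerSeries k) O PowerSeries.X} ⊔ P))) :
    ∃ (M : Submodule (O ⧸ P) (FractionRing (O ⧸ P))) (D : O ⧸ P →+ M), M.FG ∧
      (∀ x y, D (x * y) = x • D y + y • D x) ∧ (∀ c : k, D (algebraMap k (O ⧸ P) c) = 0) ∧
      (D (algebraMap (PowerSeries k) (O ⧸ P) PowerSeries.X) : FractionRing (O ⧸ P)) = 1 := by
  have := isLocalRing_quotient (Ideal.IsPrime.ne_top (I := P) inferInstance)
  have : FiniteDimensional k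
      ((O ⧸ P) ⧸ Ideal.span {algebraMap (PowerSeries k) (O ⧸ P) PowerSeries.X}) :=
    Module.Finite.equiv (quotientBaseEquiv k P).symm.toLinearEquiv
  have ht' := algebraMap_quotient_X_mem k (I := P) ht
  have := finite_of_finiteDimensional_quotient k (O ⧸ P) ht'
  have := faithfulSMul_of_torsionFree k (O ⧸ P) ht' fun x hx => by
    rw [Algebra.smul_def, mul_eq_zero] at hx
    exact hx.resolve_left fun h => htP (Ideal.Quotient.eq_zero_iff_mem.1 h)
  exact exists_derivation_extending k (O ⧸ P)

end Quotients

/-! ### General deformations and the geometric generic fibre -/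

section GenericDeformation

variable {k : Type*} [Field k] {f : PlaneRing k} {d : ℕ} {δ : Fin d → PlaneRing k} {a : Fin d → k}

instance isScalarTower_totalRing : IsScalarTower k (PowerSeries k) (TotalRing f δ a) := by
  refine IsScalarTower.of_algebraMap_eq (R := k) (S := PowerSeries k)
    (A := TotalRing f δ a) fun c => ?_
  have h1 : algebraMap k (TotalRing f δ a) c = Ideal.Quotient.mk _
      (algebraMap k (PowerSeries (PlaneRing k)) c) := rfl
  have h2 : algebraMap (PowerSeries k) (TotalRing f δ a) (algebraMap k _ c) =
      Ideal.Quotient.mk _ (algebraMap (PowerSeries k)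
        (PowerSeries (PlaneRing k)) (algebraMap k _ c)) := rfl
  rw [h1, h2, PowerSeries.algebraMap_apply, PowerSeries.algebraMap_apply'',
    PowerSeries.algebraMap_apply, PowerSeries.map_C, Algebra.algebraMap_self, RingHom.id_apply]

theorem derivative_deformationEq : PowerSeries.derivative (PlaneRing k) (deformationEq f δ a) =
    PowerSeries.C (∑ i, a i • δ i) := by
  have hC : ∀ r : PlaneRing k, PowerSeries.derivative (PlaneRing k) (PowerSeries.C r) = 0 :=
    fun r => Derivation.map_algebraMap _ r
  rw [deformationEq, map_add, Derivation.leibniz, hC, hC, PowerSeries.derivative_X, smul_zero,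
    zero_add, zero_add, smul_eq_mul, mul_one]

/-- The chain rule for derivations of a quotient of `k[[x, y]][[t]]` into a finite module. -/
theorem derivation_apply_of_surjective {A M : Type*} [CommRing A] [AddCommGroup M] [Module A M]
    [Module.Finite A M] (φ : PowerSeries (PlaneRing k) →+* A) (hφ : Function.Surjective φ)
    (D : A →+ M) (hD : ∀ x y, D (x * y) = x • D y + y • D x)
    (hk : ∀ c : k, D (φ (algebraMap k _ c)) = 0) (b : PowerSeries (PlaneRing k)) :
    D (φ b) = φ (fiberDeriv 0 b) • D (φ (PowerSeries.C (MvPowerSeries.X 0))) +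
      φ (fiberDeriv 1 b) • D (φ (PowerSeries.C (MvPowerSeries.X 1))) +
      φ (PowerSeries.derivative (PlaneRing k) b) • D (φ PowerSeries.X) := by
  let _ : Module (PowerSeries (PlaneRing k)) M := Module.compHom M φ
  have : Module.Finite (PowerSeries (PlaneRing k)) M := by
    obtain ⟨s, hs⟩ := Module.Finite.fg_top (R := A) (M := M)
    refine ⟨s, eq_top_iff.2 fun m _ => ?_⟩
    have hm : m ∈ Submodule.span A (s : Set M) := hs ▸ Submodule.mem_top
    induction hm using Submodule.span_induction with
    | mem x hx => exact Submodule.subset_span hx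
    | zero => exact zero_mem _
    | add x y _ _ hx hy => exact add_mem (hx trivial) (hy trivial)
    | smul c x _ hx =>
      obtain ⟨c, rfl⟩ := hφ c
      exact Submodule.smul_mem _ c (hx trivial)
  exact derivation_apply (D.comp φ.toAddMonoidHom) (fun x y => by
    change D (φ (x * y)) = φ x • D (φ y) + φ y • D (φ x)
    rw [map_mul, hD]) hk b

/-- If the derivative of the equation in the direction of the base is a unit, then a prime
containing the singular locus contains `t`. -/
theorem algebraMap_X_mem_of_isUnit_derivative [CharZero k] {O : Type*} [CommRing O] [IsLocalRing O]
    [IsNoetherianRing O] [Algebra k O] [Algebra (PowerSeries k) O]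
    [IsScalarTower k (PowerSeries k) O] (φ : PowerSeries (PlaneRing k) →ₐ[k] O)
    (hφ : Function.Surjective φ)
    (hX : φ PowerSeries.X = algebraMap (PowerSeries k) O PowerSeries.X)
    {F : PowerSeries (PlaneRing k)} (hF : φ F = 0)
    (hu : IsUnit (PowerSeries.derivative (PlaneRing k) F)) {P : Ideal O} [P.IsPrime]
    (hP : ∀ i, φ (fiberDeriv i F) ∈ P)
    (ht : algebraMap (PowerSeries k) O PowerSeries.X ∈ IsLocalRing.maximalIdeal O)
    (hfin : FiniteDimensional k
      (O ⧸ (Ideal.span {algebraMap (PowerSeries k) O PowerSeries.X} ⊔ P))) :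
    algebraMap (PowerSeries k) O PowerSeries.X ∈ P := by
  by_contra htP
  obtain ⟨M, D, hM, hD, hDk, hDt⟩ := exists_derivation_quotient k (P := P) ht htP hfin
  have : Module.Finite (O ⧸ P) M := Module.Finite.iff_fg.2 hM
  let ψ : PowerSeries (PlaneRing k) →+* O ⧸ P := (Ideal.Quotient.mk P).comp φ.toRingHom
  have h := derivation_apply_of_surjective ψ (Ideal.Quotient.mk_surjective.comp hφ) D hD
    (fun c => by
      change D (Ideal.Quotient.mk P (φ (algebraMap k _ c))) = 0
      rw [AlgHom.commutes]
      exact hDk c) F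
  have h0 : ∀ i, ψ (fiberDeriv i F) = 0 := fun i => Ideal.Quotient.eq_zero_iff_mem.2 (hP i)
  have hF' : ψ F = 0 := by
    change Ideal.Quotient.mk P (φ F) = 0
    rw [hF, map_zero]
  have hX' : ψ PowerSeries.X = algebraMap (PowerSeries k) (O ⧸ P) PowerSeries.X :=
    congrArg (Ideal.Quotient.mk P) hX
  -- Modulo `P` the terms in `F_x` and `F_y` drop out of `D F = 0`. What remains is `F_t D t = 0`
  -- with `F_t` a unit, against `D t = 1`.
  rw [hF', map_zero, h0, h0, zero_smul, zero_smul, zero_add, zero_add, eq_comm,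
    (hu.map ψ).smul_eq_zero, hX'] at h
  rw [h] at hDt
  exact zero_ne_one hDt

theorem IsPlanarICIS.baseParam_mem_of_singIdeal_le [CharZero k] (hf : IsPlanarICIS f)
    (hu : IsUnit (∑ i, a i • δ i)) {P : Ideal (TotalRing f δ a)} [P.IsPrime]
    (hP : singIdeal f δ a ≤ P) : baseParam f δ a ∈ P := by
  have := isLocalRing_totalRing (δ := δ) (a := a) hf.vanishes
  have := isLocalRing_curve hf.vanishes
  have : FiniteDimensional k ((PlaneRing k ⧸ Ideal.span {f}) ⧸ P.map (restrictSpecial f δ a)) := by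
    have := hf.finiteDimensional_jacobian
    exact finiteDimensional_quotient_of_le k
      (map_singIdeal (f := f) (δ := δ) (a := a) ▸ Ideal.map_mono hP)
  have hfin : FiniteDimensional k (TotalRing f δ a ⧸ (specialFiberIdeal f δ a ⊔ P)) :=
    Module.Finite.equiv (quotientSpecialEquiv f δ a P).symm.toLinearEquiv
  exact algebraMap_X_mem_of_isUnit_derivative (Ideal.Quotient.mkₐ k _) Ideal.Quotient.mk_surjective
    baseParam_eq.symm (F := deformationEq f δ a)
    (Ideal.Quotient.eq_zero_iff_mem.2 (Ideal.mem_span_singleton_self _))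
    (derivative_deformationEq (f := f) (δ := δ) (a := a) ▸ hu.map PowerSeries.C)
    (fun i => hP (Ideal.subset_span (by fin_cases i <;> simp))) baseParam_mem_maximalIdeal hfin

/-- Every minimal prime over the singular ideal contains `t`, hence is the maximal ideal, of height
two. -/
theorem IsPlanarICIS.isAdmissible_of_isUnit [CharZero k] (hf : IsPlanarICIS f)
    (hu : IsUnit (∑ i, a i • δ i)) : IsAdmissible f δ a := by
  have := isLocalRing_totalRing (δ := δ) (a := a) hf.vanishes
  have := isLocalRing_curve hf.vanishes
  rw [IsAdmissible, Ideal.height_eq_inf_minimalPrimes]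
  refine le_iInf₂ fun P hP => ?_
  have := hP.1.1
  have : FiniteDimensional k ((PlaneRing k ⧸ Ideal.span {f}) ⧸
      (singIdeal f δ a).map (restrictSpecial f δ a)) := by
    rw [map_singIdeal]
    exact hf.finiteDimensional_jacobian
  rw [eq_maximalIdeal_of_baseParam_mem (hf.baseParam_mem_of_singIdeal_le hu hP.1.2) hP.1.2]
  exact hf.two_le_height_maximalIdeal

theorem singIdeal_eq_top (hf : IsPlanarICIS f) (h : tjurinaIdeal f = ⊤) :
    singIdeal f δ a = ⊤ := by
  have := isLocalRing_totalRing (δ := δ) (a := a) hf.vanishes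
  have := isLocalRing_curve hf.vanishes
  have h1 : jacobianIdeal f = ⊤ := by
    rw [Ideal.eq_top_iff_one]
    exact tjurinaIdeal_le_comap (h ▸ Submodule.mem_top : (1 : PlaneRing k) ∈ tjurinaIdeal f)
  by_contra hne
  have h2 := Ideal.map_mono (f := restrictSpecial f δ a) (IsLocalRing.le_maximalIdeal hne)
  rw [map_singIdeal, h1, ← comap_maximalIdeal_curve,
    Ideal.map_comap_of_surjective _ (restrictSpecial_surjective f δ a)] at h2
  exact Ideal.IsPrime.ne_top inferInstance (top_le_iff.1 h2)

/-- A general one-parameter deformation is admissible. -/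
theorem IsPlanarICIS.exists_forall_isAdmissible [CharZero k] (hf : IsPlanarICIS f)
    (hδ : IsDeformationBasis f δ) : ∃ p : MvPolynomial (Fin d) k, p ≠ 0 ∧
      ∀ a : Fin d → k, MvPolynomial.eval a p ≠ 0 → IsAdmissible f δ a := by
  -- For a smooth germ `Def¹` is zero and no combination of the `δ i` is a unit, but then the
  -- singular locus is empty.
  by_cases h : tjurinaIdeal f = ⊤
  · refine ⟨1, one_ne_zero, fun a _ => ?_⟩
    rw [IsAdmissible, singIdeal_eq_top hf h, Ideal.height_top]
    exact le_top
  let ℓ : PlaneRing k →ₗ[k] k :=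
    { toFun := MvPowerSeries.constantCoeff
      map_add' := map_add _
      map_smul' := fun c x => by simp }
  -- The linear form `a ↦` constant term of `∑ aᵢ δᵢ`. It is nonzero at the coordinates of `1` in
  -- `Def¹`, as the Tjurina ideal lies in the maximal ideal.
  let p : MvPolynomial (Fin d) k := ∑ i, MvPolynomial.C (ℓ (δ i)) * MvPolynomial.X i
  have hp : ∀ a : Fin d → k, MvPolynomial.eval a p = ℓ (∑ i, a i • δ i) := fun a => by
    rw [map_sum, map_sum]
    refine Finset.sum_congr rfl fun i _ => ?_
    rw [map_mul, MvPolynomial.eval_C, MvPolynomial.eval_X, map_smul, smul_eq_mul, mul_comm]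
  refine ⟨p, fun h0 => ?_, fun a ha => hf.isAdmissible_of_isUnit ?_⟩
  · obtain ⟨b, hb⟩ := hδ
    have h1 : Ideal.Quotient.mk (tjurinaIdeal f) (∑ i, b.repr 1 i • δ i) = 1 := by
      rw [← b.sum_repr 1, map_sum]
      refine Finset.sum_congr rfl fun i _ => ?_
      rw [b.sum_repr, hb]
      rfl
    replace h1 := Ideal.Quotient.eq.1 (h1.trans (map_one _).symm)
    have h2 := mem_maximalIdeal_planeRing.1 (IsLocalRing.le_maximalIdeal h h1)
    rw [map_sub, map_one MvPowerSeries.constantCoeff] at h2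
    have h3 := hp (b.repr 1)
    rw [h0, map_zero] at h3
    change 0 = MvPowerSeries.constantCoeff (∑ i, b.repr 1 i • δ i) at h3
    rw [← h3, zero_sub, neg_eq_zero] at h2
    exact one_ne_zero h2
  · rw [hp] at ha
    rw [MvPowerSeries.isUnit_iff_constantCoeff]
    exact IsUnit.mk0 _ ha

/-- An element of `𝒪_X` with finite-dimensional restriction to the special fibre has the same
multiplicity on the geometric generic fibre. -/
theorem IsPlanarICIS.genericMultiplicity_eq (hf : IsPlanarICIS f) (H : TotalRing f δ a)
    (hfin : FiniteDimensional k
      ((PlaneRing k ⧸ Ideal.span {f}) ⧸ Ideal.span {restrictSpecial f δ a H})) :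
    genericMultiplicity f δ a (Ideal.span {H}) = specialMultiplicity f δ a (Ideal.span {H}) := by
  have := isLocalRing_totalRing (δ := δ) (a := a) hf.vanishes
  have := isLocalRing_curve hf.vanishes
  have hH := hf.mem_nonZeroDivisors (h := restrictSpecial f δ a H)
  have hfin' : FiniteDimensional k (TotalRing f δ a ⧸ (specialFiberIdeal f δ a ⊔ Ideal.span {H})) := by
    rw [← Set.image_singleton, ← Ideal.map_span] at hfin
    exact Module.Finite.equiv (quotientSpecialEquiv f δ a (Ideal.span {H})).symm.toLinearEquiv
  rw [specialMultiplicity, vdim_eq_finrank]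
  -- The zero ring is not local and is treated apart. Otherwise `O_X / (H)` is `t`-torsion-free
  -- since `H` is regular modulo `t`, hence free over `k[[t]]` with rank the special length.
  by_cases hI : Ideal.span {H} = ⊤
  · rw [hI, sup_top_eq, genericMultiplicity]
    have : Subsingleton (TotalRing f δ a ⧸ (⊤ : Ideal (TotalRing f δ a))) :=
      Ideal.Quotient.subsingleton_iff.2 rfl
    rw [vdim_eq_finrank, Module.finrank_zero_of_subsingleton, Module.finrank_zero_of_subsingleton]
  · obtain ⟨b⟩ := exists_basis_quotient k hI baseParam_mem_maximalIdeal (fun x hx => by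
      obtain ⟨y, hy⟩ := Ideal.mem_span_singleton.1 hx
      have h1 : restrictSpecial f δ a H * restrictSpecial f δ a y = 0 := by
        rw [← map_mul, restrictSpecial_eq_zero_iff]
        exact ⟨x, hy.symm⟩
      obtain ⟨z, rfl⟩ := restrictSpecial_eq_zero_iff.1 (mem_nonZeroDivisors_iff_left.1 hH _ h1)
      refine Ideal.mem_span_singleton.2 ⟨z, sub_eq_zero.1 (eq_zero_of_baseParam_mul hf.ne_zero ?_)⟩
      change baseParam f δ a * x = _ at hy
      linear_combination hy) hfin'
    rw [genericMultiplicity, vdim, rank_eq_card_basis (b.baseChange (GeometricGenericField k)),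
      Fintype.card_fin, map_natCast]
    rfl

theorem finiteDimensional_of_specialMultiplicity_eq {H : TotalRing f δ a} {e : ℕ}
    (h : specialMultiplicity f δ a (Ideal.span {H}) = e) :
    FiniteDimensional k
      ((PlaneRing k ⧸ Ideal.span {f}) ⧸ Ideal.span {restrictSpecial f δ a H}) := by
  by_contra hfin
  rw [specialMultiplicity_span_singleton, vdim_eq_top hfin] at h
  exact ENat.top_ne_natCast _ h

theorem restrictSpecial_mem_jacobianIdeal {H : TotalRing f δ a} (hH : H ∈ singIdeal f δ a) :
    restrictSpecial f δ a H ∈ jacobianIdeal f := by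
  rw [← map_singIdeal (δ := δ) (a := a)]
  exact Ideal.mem_map_of_mem _ hH

theorem exists_restrictSpecial_eq {h : PlaneRing k ⧸ Ideal.span {f}} (hh : h ∈ jacobianIdeal f) :
    ∃ H ∈ singIdeal f δ a, restrictSpecial f δ a H = h := by
  rw [← map_singIdeal (δ := δ) (a := a),
    Ideal.mem_map_iff_of_surjective _ (restrictSpecial_surjective f δ a)] at hh
  exact hh

theorem le_specialMultiplicity {e : ℕ} (hmin : ∀ h ∈ jacobianIdeal f,
      FiniteDimensional k ((PlaneRing k ⧸ Ideal.span {f}) ⧸ Ideal.span {h}) →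
      e ≤ Module.finrank k ((PlaneRing k ⧸ Ideal.span {f}) ⧸ Ideal.span {h}))
    {H : TotalRing f δ a} (hH : H ∈ singIdeal f δ a) :
    (e : ℕ∞) ≤ specialMultiplicity f δ a (Ideal.span {H}) := by
  rw [specialMultiplicity_span_singleton]
  by_cases hfin : FiniteDimensional k ((PlaneRing k ⧸ Ideal.span {f}) ⧸
      Ideal.span {restrictSpecial f δ a H})
  · rw [vdim_eq_finrank, Nat.cast_le]
    exact hmin _ (restrictSpecial_mem_jacobianIdeal hH) hfin
  · rw [vdim_eq_top hfin]
    exact le_top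

theorem exists_eval_ne_zero [Infinite k] {p : MvPolynomial (Fin d) k} (hp : p ≠ 0) :
    ∃ a, MvPolynomial.eval a p ≠ 0 := by
  by_contra! h
  exact hp (MvPolynomial.funext fun a => by rw [h, map_zero])

end GenericDeformation

end AutDeg

end

/-! ### The main theorem -/

theorem mainTheorem8 {k : Type*} [Field k] [IsAlgClosed k] [CharZero k]
    (f : AutDeg.PlaneRing k) (hf : AutDeg.IsPlanarICIS f)
    {d : ℕ} (δ : Fin d → AutDeg.PlaneRing k) (hδ : AutDeg.IsDeformationBasis f δ) :
    ∃ e : ℕ,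
      AutDeg.HasHilbertSamuelMultiplicity k (AutDeg.jacobianIdeal f) (e : ℝ) ∧
      AutDeg.weightOneAutDeg 2 f δ = (e : ℕ∞) ∧
      ∃ p : MvPolynomial (Fin d) k, p ≠ 0 ∧
        ∀ a : Fin d → k, MvPolynomial.eval a p ≠ 0 →
          AutDeg.IsAdmissible f δ a ∧
          Nonempty (Module.Basis (Fin 2) (AutDeg.TotalRing f δ a)
            (Module.Dual (AutDeg.TotalRing f δ a) (AutDeg.PrincipalParts f δ a 2))) ∧
          ∀ θ : Module.Basis (Fin 2) (AutDeg.TotalRing f δ a)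
              (Module.Dual (AutDeg.TotalRing f δ a) (AutDeg.PrincipalParts f δ a 2)),
            (∃ τ : Fin 2 → AutDeg.PrincipalParts f δ a 2,
              AutDeg.specialMultiplicity f δ a (AutDeg.degeneracyIdeal f δ a θ τ) =
                AutDeg.weightOneAutDeg 2 f δ) ∧
            ∀ τ : Fin 2 → AutDeg.PrincipalParts f δ a 2,
              AutDeg.specialMultiplicity f δ a (AutDeg.degeneracyIdeal f δ a θ τ) =
                AutDeg.weightOneAutDeg 2 f δ →
              AutDeg.genericMultiplicity f δ a (AutDeg.degeneracyIdeal f δ a θ τ) =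
                (e : ℕ∞) := by
  have : Infinite k := IsAlgClosed.instInfinite
  obtain ⟨e, he, ⟨h, hhJ, hhfin, hhe⟩, hmin⟩ := hf.exists_multiplicity
  obtain ⟨p, hp0, hp⟩ := hf.exists_forall_isAdmissible hδ
  -- Every admissible family attains `e`: lift the optimal element of `J(f)` to `(F_x, F_y)` and
  -- realise the lift as a determinant.
  have hattain : ∀ a, AutDeg.IsAdmissible f δ a →
      ∀ θ : Module.Basis (Fin 2) (AutDeg.TotalRing f δ a)
        (Module.Dual (AutDeg.TotalRing f δ a) (AutDeg.PrincipalParts f δ a 2)),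
      ∃ τ, AutDeg.specialMultiplicity f δ a (AutDeg.degeneracyIdeal f δ a θ τ) = e := by
    intro a ha θ
    obtain ⟨H, hH, rfl⟩ := AutDeg.exists_restrictSpecial_eq (δ := δ) (a := a) hhJ
    obtain ⟨τ, hτ⟩ := ha.exists_degeneracyIdeal_eq_span hf θ hH
    refine ⟨τ, ?_⟩
    rw [hτ, AutDeg.specialMultiplicity_span_singleton, AutDeg.vdim_eq_finrank, hhe]
  have hAD : AutDeg.weightOneAutDeg 2 f δ = (e : ℕ∞) := by
    refine le_antisymm ?_ (le_sInf ?_)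
    · obtain ⟨a, ha⟩ := AutDeg.exists_eval_ne_zero hp0
      obtain ⟨τ, hτ⟩ := hattain a (hp a ha) (AutDeg.dualBasis hf (hp a ha))
      exact sInf_le ⟨a, hp a ha, _, τ, hτ.symm⟩
    · rintro n ⟨a, ha, θ, τ, rfl⟩
      obtain ⟨H, hH, hτ⟩ := ha.exists_degeneracyIdeal_eq hf θ τ
      rw [hτ]
      exact AutDeg.le_specialMultiplicity hmin hH
  refine ⟨e, he, hAD, p, hp0, fun a ha => ⟨hp a ha, ⟨AutDeg.dualBasis hf (hp a ha)⟩, fun θ => ?_⟩⟩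
  rw [hAD]
  refine ⟨hattain a (hp a ha) θ, fun τ hτ => ?_⟩
  obtain ⟨H, hH, hHτ⟩ := (hp a ha).exists_degeneracyIdeal_eq hf θ τ
  rw [hHτ] at hτ ⊢
  -- Attaining the finite value `e` makes the special length finite, so it is preserved on the
  -- geometric generic fibre.
  exact (hf.genericMultiplicity_eq H
    (AutDeg.finiteDimensional_of_specialMultiplicity_eq hτ)).trans hτ
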